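/- Let $\mathfrak g=\mathfrak{sl}(3,\mathbb C)$, let $e_{ij}$ be the matrix units, and put $H_1=\frac13(2e_{11}-e_{22}-e_{33})$, $H_2=\frac13(-e_{11}+2e_{22}-e_{33})$, $H=H_1-H_2$, $E=e_{12}$, $F=e_{21}$, $E_1=e_{13}$, $E_2=e_{23}$, $F_1=e_{31}$, $F_2=e_{32}$, and $\mathfrak p=\operatorname{span}_{\mathbb C}\{E_1,E_2,F_1,F_2\}$. Let $K=S(U(2)\times U(1))$ be the group of block diagonal unitary $3\times 3$ matrices (blocks of sizes $2$ and $1$) of determinant $1$; it acts on $\mathfrak g$ and on $\mathfrak p$ by conjugation, hence by algebra automorphisms on $S(\mathfrak g)\otimes\bigwedge(\mathfrak p)$ (all over $\mathbb C$), and $(S(\mathfrak g)\otimes\bigwedge(\mathfrak p))^K$ denotes the algebra of invariants. In $S(\mathfrak g)\otimes\bigwedge(\mathfrak p)$ define \begin{align*} a&=(H_1+H_2)\otimes 1,\\ b&=(H^2+4EF)\otimes 1,\\ c&=(E_1F_1+E_2F_2)\otimes 1,\\ d&=(2EE_2F_1+HE_1F_1-HE_2F_2+2FE_1F_2)\otimes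 1,\\ e&=F_1\otimes E_1+F_2\otimes E_2,\\ f&=E_1\otimes F_1+E_2\otimes F_2,\\ g&=1\otimes(E_1\wedge F_1+E_2\wedge F_2),\\ h&=(2EE_2+HE_1)\otimes F_1+(-HE_2+2FE_1)\otimes F_2,\\ i&=2E\otimes E_2\wedge F_1+H\otimes E_1\wedge F_1-H\otimes E_2\wedge F_2+2F\otimes E_1\wedge F_2,\\ j&=(HF_1+2FF_2)\otimes E_1+(2EF_1-HF_2)\otimes E_2. \end{align*} Let $S=\{a^{n_1}b^{n_2}c^{n_3}d^{n_4} : n_1,n_2,n_3,n_4\in\mathbb N_0\}$ and $T=\{1,e,f,g,h,i,j,ef,eg,fg,g^2,ei,ej,fh,fi,fj\}$. Then $S$ and $T$ are contained in $(S(\mathfrak g)\otimes\bigwedge(\mathfrak p))^K$, and the set $S\cdot T$ of products of elements of $S$ and $T$ is a basis of the complex vector space $(S(\mathfrak g)\otimes\bigwedge(\mathfrak p))^K$; moreover the products $st$ ($s=a^{n_1}b^{n_2}c^{n_3}d^{n_4}$, $t$ one of the $16$ listed elements) for different choices of $(n_1,n_2,n_3,n_4)$ and $t$ are distinct. -/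

import Mathlib

open scoped TensorProduct Matrix

noncomputable section

namespace SU21

/-- The complex Lie algebra `𝔤 = 𝔰𝔩(3, ℂ)`, the complexification of `𝔰𝔲(2,1)`. -/
abbrev g : Type := LieAlgebra.SpecialLinear.sl (Fin 3) ℂ

/-- `H₁ = (1/3) (2 e₁₁ - e₂₂ - e₃₃)`. -/
def H₁ : g := ⟨Matrix.diagonal ![2 / 3, -1 / 3, -1 / 3], by
  change Matrix.trace (Matrix.diagonal _ : Matrix (Fin 3) (Fin 3) ℂ) = 0
  simp [Matrix.trace, Fin.sum_univ_three]; norm_num⟩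

/-- `H₂ = (1/3) (-e₁₁ + 2 e₂₂ - e₃₃)`. -/
def H₂ : g := ⟨Matrix.diagonal ![-1 / 3, 2 / 3, -1 / 3], by
  change Matrix.trace (Matrix.diagonal _ : Matrix (Fin 3) (Fin 3) ℂ) = 0
  simp [Matrix.trace, Fin.sum_univ_three]; norm_num⟩

/-- `H = H₁ - H₂`. -/
def H : g := H₁ - H₂

/-- `E = e₁₂`. -/
def E : g := LieAlgebra.SpecialLinear.single 0 1 (by decide) 1

/-- `F = e₂₁`. -/
def F : g := LieAlgebra.SpecialLinear.single 1 0 (by decide) 1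

/-- `E₁ = e₁₃`. -/
def E₁ : g := LieAlgebra.SpecialLinear.single 0 2 (by decide) 1

/-- `E₂ = e₂₃`. -/
def E₂ : g := LieAlgebra.SpecialLinear.single 1 2 (by decide) 1

/-- `F₁ = e₃₁`. -/
def F₁ : g := LieAlgebra.SpecialLinear.single 2 0 (by decide) 1

/-- `F₂ = e₃₂`. -/
def F₂ : g := LieAlgebra.SpecialLinear.single 2 1 (by decide) 1

/-- The subspace `𝔭 = span {E₁, E₂, F₁, F₂}` of the Cartan decomposition `𝔤 = 𝔨 ⊕ 𝔭`. -/
def p : Submodule ℂ g := Submodule.span ℂ {E₁, E₂, F₁, F₂}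

theorem E₁_mem : E₁ ∈ p := Submodule.subset_span (by simp)
theorem E₂_mem : E₂ ∈ p := Submodule.subset_span (by simp)
theorem F₁_mem : F₁ ∈ p := Submodule.subset_span (by simp)
theorem F₂_mem : F₂ ∈ p := Submodule.subset_span (by simp)

/-- The group `K = S(U(2) × U(1))` of block diagonal unitary matrices of determinant one,
with blocks of sizes two and one. -/
def K : Subgroup (Matrix.SpecialLinearGroup (Fin 3) ℂ) where
  carrier := {k | (k : Matrix (Fin 3) (Fin 3) ℂ)ᴴ * (k : Matrix (Fin 3) (Fin 3) ℂ) = 1 ∧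
    k.1 0 2 = 0 ∧ k.1 1 2 = 0 ∧ k.1 2 0 = 0 ∧ k.1 2 1 = 0}
  one_mem' := by simp
  mul_mem' := by
    rintro x y ⟨hx, x1, x2, x3, x4⟩ ⟨hy, y1, y2, y3, y4⟩
    refine ⟨?_, ?_⟩
    · rw [Matrix.SpecialLinearGroup.coe_mul, Matrix.conjTranspose_mul, Matrix.mul_assoc,
        ← Matrix.mul_assoc _ x.1 y.1, hx, Matrix.one_mul, hy]
    · simp [Matrix.mul_apply, Fin.sum_univ_three, *]
  inv_mem' := by
    rintro x ⟨hx, x1, x2, x3, x4⟩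
    have h : (x⁻¹).1 = (x : Matrix (Fin 3) (Fin 3) ℂ)ᴴ := by
      have h1 : (x.1) * (x⁻¹).1 = 1 := by
        rw [← Matrix.SpecialLinearGroup.coe_mul, mul_inv_cancel,
          Matrix.SpecialLinearGroup.coe_one]
      calc (x⁻¹).1 = (x.1ᴴ * x.1) * (x⁻¹).1 := by rw [hx, Matrix.one_mul]
        _ = x.1ᴴ := by rw [Matrix.mul_assoc, h1, Matrix.mul_one]
    refine ⟨?_, ?_⟩
    · rw [h, Matrix.conjTranspose_conjTranspose]
      exact mul_eq_one_comm.mp hx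
    · rw [h]
      simp [*]

/-- The adjoint action `X ↦ k X k⁻¹` on `𝔤`. -/
def Ad (k : Matrix.SpecialLinearGroup (Fin 3) ℂ) : g →ₗ[ℂ] g where
  toFun X := ⟨k.1 * X.1 * (k⁻¹).1, by
    change Matrix.trace (k.1 * X.1 * (k⁻¹).1) = 0
    have hX : Matrix.trace X.1 = 0 := X.2
    have h1 : (k⁻¹).1 * k.1 = 1 := by
      rw [← Matrix.SpecialLinearGroup.coe_mul, inv_mul_cancel, Matrix.SpecialLinearGroup.coe_one]
    rw [Matrix.trace_mul_comm, ← Matrix.mul_assoc, h1, Matrix.one_mul, hX]⟩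
  map_add' X Y := by
    apply Subtype.ext
    change k.1 * (X.1 + Y.1) * (k⁻¹).1 = k.1 * X.1 * (k⁻¹).1 + k.1 * Y.1 * (k⁻¹).1
    rw [Matrix.mul_add, Matrix.add_mul]
  map_smul' c X := by
    apply Subtype.ext
    change k.1 * (c • X.1) * (k⁻¹).1 = c • (k.1 * X.1 * (k⁻¹).1)
    rw [Matrix.mul_smul, Matrix.smul_mul]

theorem mem_p_iff (X : g) :
    X ∈ p ↔ X.1 0 0 = 0 ∧ X.1 0 1 = 0 ∧ X.1 1 0 = 0 ∧ X.1 1 1 = 0 ∧ X.1 2 2 = 0 := by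
  constructor
  · intro h
    induction h using Submodule.span_induction with
    | mem x hx =>
      rcases hx with rfl | rfl | rfl | rfl <;>
        simp [E₁, E₂, F₁, F₂]
    | zero => simp
    | add x y _ _ hx hy => simp [hx, hy]
    | smul c x _ hx => simp [hx]
  · rintro ⟨h1, h2, h3, h4, h5⟩
    have hX : X = X.1 0 2 • E₁ + X.1 1 2 • E₂ + X.1 2 0 • F₁ + X.1 2 1 • F₂ := by
      apply Subtype.ext
      ext i j
      fin_cases i <;> fin_cases j <;> simp [E₁, E₂, F₁, F₂, *]
    rw [hX]
    exact p.add_mem (p.add_mem (p.add_mem (p.smul_mem _ E₁_mem) (p.smul_mem _ E₂_mem))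
      (p.smul_mem _ F₁_mem)) (p.smul_mem _ F₂_mem)

/-- `𝔭` is stable under the adjoint action of `K`. -/
theorem Ad_mem_p (k : K) : ∀ X ∈ p, Ad k.1 X ∈ p := by
  intro X hX
  obtain ⟨-, k1, k2, k3, k4⟩ := k.2
  obtain ⟨-, l1, l2, l3, l4⟩ := (k⁻¹).2
  rw [mem_p_iff] at hX ⊢
  obtain ⟨h1, h2, h3, h4, h5⟩ := hX
  have key : (Ad k.1 X).1 = k.1.1 * X.1 * (k⁻¹).1.1 := rfl
  rw [key]
  simp only [Matrix.mul_apply, Fin.sum_univ_three, k1, k2, k3, k4, l1, l2, l3, l4,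
    h1, h2, h3, h4, h5]
  simp

/-- The adjoint action of `K` on `𝔭`. -/
def AdP (k : K) : p →ₗ[ℂ] p := (Ad k.1).restrict (Ad_mem_p k)

/-- The algebra `S(𝔤) ⊗ ⋀(𝔭)`. -/
abbrev A : Type := SymmetricAlgebra ℂ g ⊗[ℂ] ExteriorAlgebra ℂ p

/-- The action of `k ∈ K` on `S(𝔤) ⊗ ⋀(𝔭)` by algebra automorphisms, induced on both factors
by the adjoint action. -/
def act (k : K) : A →ₐ[ℂ] A :=
  Algebra.TensorProduct.map
    (SymmetricAlgebra.lift ((SymmetricAlgebra.ι ℂ g).comp (Ad k.1)))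
    (ExteriorAlgebra.map (AdP k))

/-- The algebra `(S(𝔤) ⊗ ⋀(𝔭))^K` of `K`-invariants. -/
def invariants : Subalgebra ℂ A where
  carrier := {x | ∀ k : K, act k x = x}
  mul_mem' hx hy k := by rw [map_mul, hx k, hy k]
  add_mem' hx hy k := by rw [map_add, hx k, hy k]
  algebraMap_mem' r k := (act k).commutes r

/-- The element `X ⊗ 1` of `S(𝔤) ⊗ ⋀(𝔭)`, for `X ∈ 𝔤`. -/
def s (X : g) : A := SymmetricAlgebra.ι ℂ g X ⊗ₜ[ℂ] 1

/-- The element `1 ⊗ X` of `S(𝔤) ⊗ ⋀(𝔭)`, for `X ∈ 𝔭`. -/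
def w (X : g) (hX : X ∈ p) : A := 1 ⊗ₜ[ℂ] ExteriorAlgebra.ι ℂ (⟨X, hX⟩ : p)

/-- `1 ⊗ E₁`. -/
def e₁ : A := w E₁ E₁_mem
/-- `1 ⊗ E₂`. -/
def e₂ : A := w E₂ E₂_mem
/-- `1 ⊗ F₁`. -/
def f₁ : A := w F₁ F₁_mem
/-- `1 ⊗ F₂`. -/
def f₂ : A := w F₂ F₂_mem

/-! In the formulas below, `s X * w Y hY` is `X ⊗ Y`, and a product of two elements `1 ⊗ X` and
`1 ⊗ Y` is `1 ⊗ (X ∧ Y)`. -/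

/-- `a = (H₁ + H₂) ⊗ 1`. -/
def a : A := s (H₁ + H₂)

/-- `b = (H² + 4 E F) ⊗ 1`. -/
def b : A := s H ^ 2 + 4 * s E * s F

/-- `c = (E₁ F₁ + E₂ F₂) ⊗ 1`. -/
def c : A := s E₁ * s F₁ + s E₂ * s F₂

/-- `d = (2 E E₂ F₁ + H E₁ F₁ - H E₂ F₂ + 2 F E₁ F₂) ⊗ 1`. -/
def d : A :=
  2 * s E * s E₂ * s F₁ + s H * s E₁ * s F₁ - s H * s E₂ * s F₂ + 2 * s F * s E₁ * s F₂

/-- `e = F₁ ⊗ E₁ + F₂ ⊗ E₂`. -/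
def e : A := s F₁ * e₁ + s F₂ * e₂

/-- `f = E₁ ⊗ F₁ + E₂ ⊗ F₂`. -/
def f : A := s E₁ * f₁ + s E₂ * f₂

/-- `g = 1 ⊗ (E₁ ∧ F₁ + E₂ ∧ F₂)`. -/
def gg : A := e₁ * f₁ + e₂ * f₂

/-- `h = (2 E E₂ + H E₁) ⊗ F₁ + (-H E₂ + 2 F E₁) ⊗ F₂`. -/
def h : A :=
  (2 * s E * s E₂ + s H * s E₁) * f₁ + (-(s H * s E₂) + 2 * s F * s E₁) * f₂

/-- `i = 2 E ⊗ E₂ ∧ F₁ + H ⊗ E₁ ∧ F₁ - H ⊗ E₂ ∧ F₂ + 2 F ⊗ E₁ ∧ F₂`. -/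
def i : A :=
  2 * s E * (e₂ * f₁) + s H * (e₁ * f₁) - s H * (e₂ * f₂) + 2 * s F * (e₁ * f₂)

/-- `j = (H F₁ + 2 F F₂) ⊗ E₁ + (2 E F₁ - H F₂) ⊗ E₂`. -/
def j : A :=
  (s H * s F₁ + 2 * s F * s F₂) * e₁ + (2 * s E * s F₁ - s H * s F₂) * e₂

/-- The monomial `a ^ n₁ b ^ n₂ c ^ n₃ d ^ n₄`. -/
def monom (n : Fin 4 → ℕ) : A := a ^ n 0 * b ^ n 1 * c ^ n 2 * d ^ n 3

/-- The sixteen elements of `T`, listed. -/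
def tElem : Fin 16 → A :=
  ![1, e, f, gg, h, i, j, e * f, e * gg, f * gg, gg ^ 2, e * i, e * j, f * h, f * i, f * j]

/-- `S = {a ^ n₁ b ^ n₂ c ^ n₃ d ^ n₄}`. -/
def S : Set A := Set.range monom

/-- `T = {1, e, f, g, h, i, j, ef, eg, fg, g², ei, ej, fh, fi, fj}`. -/
def T : Set A :=
  {1, e, f, gg, h, i, j, e * f, e * gg, f * gg, gg ^ 2, e * i, e * j, f * h, f * i, f * j}

theorem T_eq_range : T = Set.range tElem := by
  simp only [T, tElem, Matrix.range_cons, Matrix.range_empty, Set.union_empty,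
    Set.insert_eq]

/-- The set `S · T` of products. -/
def ST : Set A := {x | ∃ y ∈ S, ∃ t ∈ T, x = y * t}

end SU21

end

noncomputable section

namespace SU21

set_option linter.unusedSimpArgs false

/-! An element of `S(𝔤) ⊗ ⋀(𝔭)` is regarded as a polynomial map from the dual of `𝔤` to the
16-dimensional space `⋀(𝔭)`, and a `K`-invariant element as an equivariant map. By the unitarian
trick, equivariance under the compact group `K` extends to the block matrices in its
complexification `KC` with no zero entry in the 2 × 2 block (`pull_blockKC_eq_ev`).

The slices `sliceF` and `sliceE` are sections of the map `x ↦ (a, b, c, d)(x)`, and a generic point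
is `KC`-conjugate to the point of `sliceF` with the same invariants (`exists_map_adP_ev_sliceF`).
Hence an invariant element is determined by its restriction to `sliceF`, where `a, b, c, d` become
the free parameters `r 0, ..., r 3`. Where `bc² - d² ≠ 0`, the values of the sixteen elements of `T`
form a basis of `⋀(𝔭)` (`linearIndependent_ev_sliceF`). This gives linear independence of `S · T`,
and shows that an invariant is a combination of `T` whose coefficients are rational functions of
`r`.

For spanning, the coefficients must be polynomials. A single slice leaves denominators, but generic
`sliceE r` is conjugate to `sliceF r`, so the same coefficients serve on both
(`exists_coordinates`). Fourteen of them can be read off from one slice or the other; the remaining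
two, those of `ef` and `fj`, become polynomial through a divisibility argument using the coprimality
of `r 2` and `r 3` (`exists_polynomial_coordinates`). Substituting `a, b, c, d` for the parameters
expresses the invariant through `S · T`. -/

/-! ### Evaluation at points of the dual of `𝔤`. -/

/-- Evaluation of the symmetric factor of `S(𝔤) ⊗ ⋀(𝔭)` at a point of the dual of `𝔤`. -/
def ev (x : Module.Dual ℂ g) : A →ₐ[ℂ] ExteriorAlgebra ℂ p :=
  Algebra.TensorProduct.lift
    ((Algebra.ofId ℂ (ExteriorAlgebra ℂ p)).comp (SymmetricAlgebra.lift x)) (AlgHom.id ℂ _)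
    (fun y _ => Algebra.commutes (SymmetricAlgebra.lift x y) _)

theorem ev_tmul (x : Module.Dual ℂ g) (y : SymmetricAlgebra ℂ g) (m : ExteriorAlgebra ℂ p) :
    ev x (y ⊗ₜ m) = SymmetricAlgebra.lift x y • m := by
  rw [Algebra.smul_def]
  exact Algebra.TensorProduct.lift_tmul _ _ _ _ _

theorem ev_s (x : Module.Dual ℂ g) (X : g) : ev x (s X) = algebraMap ℂ _ (x X) := by
  simp [s, ev_tmul, Algebra.algebraMap_eq_smul_one]

theorem ev_ofNat (x : Module.Dual ℂ g) (n : ℕ) [n.AtLeastTwo] :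
    ev x (no_index (OfNat.ofNat n)) = algebraMap ℂ _ (OfNat.ofNat n) := by
  rw [map_ofNat (algebraMap ℂ (ExteriorAlgebra ℂ p)) n, map_ofNat (ev x) n]

theorem ev_w (x : Module.Dual ℂ g) (X : g) (hX : X ∈ p) :
    ev x (w X hX) = ExteriorAlgebra.ι ℂ (⟨X, hX⟩ : p) := by
  simp [w, ev_tmul]

/-- The vector `E₁` in `⋀(𝔭)`. -/
def εE₁ : ExteriorAlgebra ℂ p := ExteriorAlgebra.ι ℂ ⟨E₁, E₁_mem⟩
/-- The vector `E₂` in `⋀(𝔭)`. -/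
def εE₂ : ExteriorAlgebra ℂ p := ExteriorAlgebra.ι ℂ ⟨E₂, E₂_mem⟩
/-- The vector `F₁` in `⋀(𝔭)`. -/
def εF₁ : ExteriorAlgebra ℂ p := ExteriorAlgebra.ι ℂ ⟨F₁, F₁_mem⟩
/-- The vector `F₂` in `⋀(𝔭)`. -/
def εF₂ : ExteriorAlgebra ℂ p := ExteriorAlgebra.ι ℂ ⟨F₂, F₂_mem⟩

section values

variable (x : Module.Dual ℂ g)

theorem ev_a : ev x a = algebraMap ℂ _ (x (H₁ + H₂)) := ev_s _ _

theorem ev_b : ev x b = algebraMap ℂ _ (x H ^ 2 + 4 * x E * x F) := by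
  simp [b, ev_s, ev_ofNat]

theorem ev_c : ev x c = algebraMap ℂ _ (x E₁ * x F₁ + x E₂ * x F₂) := by
  simp [c, ev_s]

theorem ev_d : ev x d = algebraMap ℂ _
    (2 * x E * x E₂ * x F₁ + x H * x E₁ * x F₁ - x H * x E₂ * x F₂ + 2 * x F * x E₁ * x F₂) := by
  simp [d, ev_s, ev_ofNat]

theorem ev_e : ev x e = x F₁ • εE₁ + x F₂ • εE₂ := by
  simp [e, ev_s, ev_ofNat, ev_w, e₁, e₂, Algebra.smul_def, εE₁, εE₂]

theorem ev_f : ev x f = x E₁ • εF₁ + x E₂ • εF₂ := by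
  simp [f, ev_s, ev_ofNat, ev_w, f₁, f₂, Algebra.smul_def, εF₁, εF₂]

theorem ev_gg : ev x gg = εE₁ * εF₁ + εE₂ * εF₂ := by
  simp [gg, ev_w, e₁, e₂, f₁, f₂, εE₁, εE₂, εF₁, εF₂]

theorem ev_h : ev x h = (2 * x E * x E₂ + x H * x E₁) • εF₁ +
    (-(x H * x E₂) + 2 * x F * x E₁) • εF₂ := by
  simp [h, ev_s, ev_ofNat, ev_w, f₁, f₂, Algebra.smul_def, εF₁, εF₂]

theorem ev_i : ev x i = (2 * x E) • (εE₂ * εF₁) + x H • (εE₁ * εF₁) - x H • (εE₂ * εF₂) +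
    (2 * x F) • (εE₁ * εF₂) := by
  simp [i, ev_s, ev_ofNat, ev_w, e₁, e₂, f₁, f₂, Algebra.smul_def, εE₁, εE₂, εF₁, εF₂]

theorem ev_j : ev x j = (x H * x F₁ + 2 * x F * x F₂) • εE₁ +
    (2 * x E * x F₁ - x H * x F₂) • εE₂ := by
  simp [j, ev_s, ev_ofNat, ev_w, e₁, e₂, Algebra.smul_def, εE₁, εE₂]

end values

/-! ### The monomial basis of `⋀(𝔭)`. -/

/-- The monomials in `E₁, E₂, F₁, F₂` in `⋀(𝔭)`. -/
def extMon : Fin 16 → ExteriorAlgebra ℂ p :=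
  ![1, εE₁, εE₂, εF₁, εF₂, εE₁ * εE₂, εE₁ * εF₁, εE₁ * εF₂, εE₂ * εF₁, εE₂ * εF₂, εF₁ * εF₂,
    εE₁ * (εE₂ * εF₁), εE₁ * (εE₂ * εF₂), εE₁ * (εF₁ * εF₂), εE₂ * (εF₁ * εF₂),
    εE₁ * (εE₂ * (εF₁ * εF₂))]

theorem ι_mul_swap (x y : p) : ExteriorAlgebra.ι ℂ y * ExteriorAlgebra.ι ℂ x =
    -(ExteriorAlgebra.ι ℂ x * ExteriorAlgebra.ι ℂ y) :=
  eq_neg_of_add_eq_zero_left (ExteriorAlgebra.ι_add_mul_swap y x)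

theorem ι_mul_swap_assoc (x y : p) (z : ExteriorAlgebra ℂ p) :
    ExteriorAlgebra.ι ℂ y * (ExteriorAlgebra.ι ℂ x * z) =
    -(ExteriorAlgebra.ι ℂ x * (ExteriorAlgebra.ι ℂ y * z)) := by
  rw [← mul_assoc, ι_mul_swap, neg_mul, mul_assoc]

theorem ι_mul_self_assoc (x : p) (z : ExteriorAlgebra ℂ p) :
    ExteriorAlgebra.ι ℂ x * (ExteriorAlgebra.ι ℂ x * z) = 0 := by
  rw [← mul_assoc, ExteriorAlgebra.ι_sq_zero, zero_mul]

theorem ε_sq : εE₁ * εE₁ = 0 ∧ εE₂ * εE₂ = 0 ∧ εF₁ * εF₁ = 0 ∧ εF₂ * εF₂ = 0 :=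
  ⟨ExteriorAlgebra.ι_sq_zero _, ExteriorAlgebra.ι_sq_zero _, ExteriorAlgebra.ι_sq_zero _,
    ExteriorAlgebra.ι_sq_zero _⟩

theorem ε_sq_assoc (z : ExteriorAlgebra ℂ p) :
    εE₁ * (εE₁ * z) = 0 ∧ εE₂ * (εE₂ * z) = 0 ∧ εF₁ * (εF₁ * z) = 0 ∧ εF₂ * (εF₂ * z) = 0 :=
  ⟨ι_mul_self_assoc _ z, ι_mul_self_assoc _ z, ι_mul_self_assoc _ z, ι_mul_self_assoc _ z⟩

theorem ε_swap : εE₂ * εE₁ = -(εE₁ * εE₂) ∧ εF₁ * εE₁ = -(εE₁ * εF₁) ∧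
    εF₂ * εE₁ = -(εE₁ * εF₂) ∧ εF₁ * εE₂ = -(εE₂ * εF₁) ∧ εF₂ * εE₂ = -(εE₂ * εF₂) ∧
    εF₂ * εF₁ = -(εF₁ * εF₂) :=
  ⟨ι_mul_swap _ _, ι_mul_swap _ _, ι_mul_swap _ _, ι_mul_swap _ _, ι_mul_swap _ _,
    ι_mul_swap _ _⟩

theorem ε_swap_assoc (z : ExteriorAlgebra ℂ p) : εE₂ * (εE₁ * z) = -(εE₁ * (εE₂ * z)) ∧
    εF₁ * (εE₁ * z) = -(εE₁ * (εF₁ * z)) ∧ εF₂ * (εE₁ * z) = -(εE₁ * (εF₂ * z)) ∧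
    εF₁ * (εE₂ * z) = -(εE₂ * (εF₁ * z)) ∧ εF₂ * (εE₂ * z) = -(εE₂ * (εF₂ * z)) ∧
    εF₂ * (εF₁ * z) = -(εF₁ * (εF₂ * z)) :=
  ⟨ι_mul_swap_assoc _ _ z, ι_mul_swap_assoc _ _ z, ι_mul_swap_assoc _ _ z,
    ι_mul_swap_assoc _ _ z, ι_mul_swap_assoc _ _ z, ι_mul_swap_assoc _ _ z⟩

theorem eq_of_mem_p (X : p) : X = X.1.1 0 2 • (⟨E₁, E₁_mem⟩ : p) + X.1.1 1 2 • ⟨E₂, E₂_mem⟩ +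
    X.1.1 2 0 • ⟨F₁, F₁_mem⟩ + X.1.1 2 1 • ⟨F₂, F₂_mem⟩ := by
  obtain ⟨X, hX⟩ := X
  obtain ⟨h1, h2, h3, h4, h5⟩ := (mem_p_iff X).1 hX
  apply Subtype.ext
  apply Subtype.ext
  ext i j
  fin_cases i <;> fin_cases j <;> simp [E₁, E₂, F₁, F₂, *]

/-- The coordinates of an element of `𝔭`. -/
def coordP : p →ₗ[ℂ] (Fin 4 → ℂ) where
  toFun X := ![X.1.1 0 2, X.1.1 1 2, X.1.1 2 0, X.1.1 2 1]
  map_add' X Y := by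
    change ![X.1.1 0 2 + Y.1.1 0 2, X.1.1 1 2 + Y.1.1 1 2, X.1.1 2 0 + Y.1.1 2 0,
      X.1.1 2 1 + Y.1.1 2 1] = _
    simp
  map_smul' r X := by
    change ![r * X.1.1 0 2, r * X.1.1 1 2, r * X.1.1 2 0, r * X.1.1 2 1] = _
    simp

theorem coordP_bijective : Function.Bijective coordP := by
  constructor
  · rw [← LinearMap.ker_eq_bot, LinearMap.ker_eq_bot']
    intro X hX
    have h0 : X.1.1 0 2 = 0 := congrFun hX 0
    have h1 : X.1.1 1 2 = 0 := congrFun hX 1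
    have h2 : X.1.1 2 0 = 0 := congrFun hX 2
    have h3 : X.1.1 2 1 = 0 := congrFun hX 3
    rw [eq_of_mem_p X, h0, h1, h2, h3]
    simp
  · intro v
    refine ⟨v 0 • (⟨E₁, E₁_mem⟩ : p) + v 1 • ⟨E₂, E₂_mem⟩ +
        v 2 • ⟨F₁, F₁_mem⟩ + v 3 • ⟨F₂, F₂_mem⟩, ?_⟩
    have h0 : coordP ⟨E₁, E₁_mem⟩ = Pi.single 0 1 := by
      ext k; fin_cases k <;> simp [coordP, E₁]
    have h1 : coordP ⟨E₂, E₂_mem⟩ = Pi.single 1 1 := by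
      ext k; fin_cases k <;> simp [coordP, E₂]
    have h2 : coordP ⟨F₁, F₁_mem⟩ = Pi.single 2 1 := by
      ext k; fin_cases k <;> simp [coordP, F₁]
    have h3 : coordP ⟨F₂, F₂_mem⟩ = Pi.single 3 1 := by
      ext k; fin_cases k <;> simp [coordP, F₂]
    rw [map_add, map_add, map_add, map_smul, map_smul, map_smul, map_smul, h0, h1, h2, h3]
    ext k
    fin_cases k <;> simp

/-- The basis `E₁, E₂, F₁, F₂` of `𝔭`. -/
def basisP : Module.Basis (Fin 4) ℂ p :=
  Module.Basis.ofEquivFun (LinearEquiv.ofBijective coordP coordP_bijective)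

theorem finrank_exteriorAlgebra_p : Module.finrank ℂ (ExteriorAlgebra ℂ p) = 16 := by
  rw [Module.finrank_eq_card_basis basisP.ExteriorAlgebra]
  simp

theorem εE₁_mul_extMon (k : Fin 16) : εE₁ * extMon k = 0 ∨
    ∃ l, εE₁ * extMon k = extMon l ∨ εE₁ * extMon k = -extMon l := by
  fin_cases k <;> simp [extMon, ε_sq, ε_sq_assoc, ε_swap, ε_swap_assoc, Fin.exists_fin_succ]

theorem εE₂_mul_extMon (k : Fin 16) : εE₂ * extMon k = 0 ∨
    ∃ l, εE₂ * extMon k = extMon l ∨ εE₂ * extMon k = -extMon l := by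
  fin_cases k <;> simp [extMon, ε_sq, ε_sq_assoc, ε_swap, ε_swap_assoc, Fin.exists_fin_succ]

theorem εF₁_mul_extMon (k : Fin 16) : εF₁ * extMon k = 0 ∨
    ∃ l, εF₁ * extMon k = extMon l ∨ εF₁ * extMon k = -extMon l := by
  fin_cases k <;> simp [extMon, ε_sq, ε_sq_assoc, ε_swap, ε_swap_assoc, Fin.exists_fin_succ]

theorem εF₂_mul_extMon (k : Fin 16) : εF₂ * extMon k = 0 ∨
    ∃ l, εF₂ * extMon k = extMon l ∨ εF₂ * extMon k = -extMon l := by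
  fin_cases k <;> simp [extMon, ε_sq, ε_sq_assoc, ε_swap, ε_swap_assoc, Fin.exists_fin_succ]

/-- Left multiplication by a generator sends each monomial to zero or to a monomial up to sign. The
span is therefore a left ideal, and it contains `1`. -/
theorem span_extMon : ⊤ ≤ Submodule.span ℂ (Set.range extMon) := by
  have hmem (k : Fin 16) : extMon k ∈ Submodule.span ℂ (Set.range extMon) :=
    Submodule.subset_span ⟨k, rfl⟩
  have key (t : ExteriorAlgebra ℂ p)
      (ht : ∀ k, t * extMon k = 0 ∨ ∃ l, t * extMon k = extMon l ∨ t * extMon k = -extMon l)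
      (y : ExteriorAlgebra ℂ p) (hy : y ∈ Submodule.span ℂ (Set.range extMon)) :
      t * y ∈ Submodule.span ℂ (Set.range extMon) := by
    induction hy using Submodule.span_induction with
    | mem y hy =>
      obtain ⟨k, rfl⟩ := hy
      rcases ht k with h0 | ⟨l, h0 | h0⟩ <;> rw [h0]
      · exact zero_mem _
      · exact hmem l
      · exact neg_mem (hmem l)
    | zero => simp
    | add y z _ _ hy hz => rw [mul_add]; exact add_mem hy hz
    | smul r y _ hy => rw [mul_smul_comm]; exact Submodule.smul_mem _ _ hy
  have hE₁ := key εE₁ εE₁_mul_extMon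
  have hE₂ := key εE₂ εE₂_mul_extMon
  have hF₁ := key εF₁ εF₁_mul_extMon
  have hF₂ := key εF₂ εF₂_mul_extMon
  have hι (X : p) : ∀ y ∈ Submodule.span ℂ (Set.range extMon),
      ExteriorAlgebra.ι ℂ X * y ∈ Submodule.span ℂ (Set.range extMon) := by
    intro y hy
    rw [eq_of_mem_p X]
    simp only [map_add, map_smul, add_mul, smul_mul_assoc]
    exact add_mem (add_mem (add_mem (Submodule.smul_mem _ _ (hE₁ y hy))
      (Submodule.smul_mem _ _ (hE₂ y hy))) (Submodule.smul_mem _ _ (hF₁ y hy)))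
      (Submodule.smul_mem _ _ (hF₂ y hy))
  have hall (t : ExteriorAlgebra ℂ p) : ∀ y ∈ Submodule.span ℂ (Set.range extMon),
      t * y ∈ Submodule.span ℂ (Set.range extMon) := by
    induction t using ExteriorAlgebra.induction with
    | algebraMap r => intro y hy; rw [← Algebra.smul_def]; exact Submodule.smul_mem _ _ hy
    | ι X => exact hι X
    | mul u v hu hv => intro y hy; rw [mul_assoc]; exact hu _ (hv y hy)
    | add u v hu hv => intro y hy; rw [add_mul]; exact add_mem (hu y hy) (hv y hy)
  intro t _
  have := hall t 1 (hmem 0)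
  rwa [mul_one] at this

/-- The monomial basis of `⋀(𝔭)`. -/
def extBasis : Module.Basis (Fin 16) ℂ (ExteriorAlgebra ℂ p) :=
  basisOfTopLeSpanOfCardEqFinrank extMon span_extMon (by simp [finrank_exteriorAlgebra_p])

theorem extBasis_apply (k : Fin 16) : extBasis k = extMon k := by
  simp [extBasis]

/-! ### Elements are determined by their values at generic points. -/

theorem eq_zero_of_lift_eq_zero (y : SymmetricAlgebra ℂ g)
    (hy : ∀ x : Module.Dual ℂ g, SymmetricAlgebra.lift x y = 0) : y = 0 := by
  let B := Module.finBasis ℂ g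
  let q := SymmetricAlgebra.equivMvPolynomial B
  apply q.injective
  rw [map_zero]
  apply MvPolynomial.funext
  intro v
  rw [map_zero, ← hy (B.constr ℂ v)]
  have : (MvPolynomial.aeval v).comp q.toAlgHom = SymmetricAlgebra.lift (B.constr ℂ v) := by
    apply SymmetricAlgebra.algHom_ext
    apply B.ext
    intro k
    simp [q]
  rw [← this]
  rfl

/-- Each coordinate of `φ` times `P` vanishes at every point, and `S(𝔤)` is a domain. Thus it
suffices to test off a hypersurface. -/
theorem eq_zero_of_ev_eq_zero (φ : A) (P : SymmetricAlgebra ℂ g) (hP : P ≠ 0)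
    (h : ∀ x : Module.Dual ℂ g, SymmetricAlgebra.lift x P ≠ 0 → ev x φ = 0) : φ = 0 := by
  let B := Algebra.TensorProduct.basis (SymmetricAlgebra ℂ g) extBasis
  have hφ : φ = ∑ k, B.repr φ k ⊗ₜ[ℂ] extBasis k := by
    conv_lhs => rw [← B.sum_repr φ]
    refine Finset.sum_congr rfl fun k _ => ?_
    rw [Algebra.TensorProduct.basis_apply, TensorProduct.smul_tmul', smul_eq_mul, mul_one]
  have hz : ∀ k, B.repr φ k = 0 := by
    intro k
    have : P * B.repr φ k = 0 := by
      apply eq_zero_of_lift_eq_zero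
      intro x
      rw [map_mul]
      by_cases hx : SymmetricAlgebra.lift x P = 0
      · rw [hx, zero_mul]
      · have h1 := h x hx
        rw [hφ, map_sum] at h1
        simp only [ev_tmul] at h1
        have h2 := Fintype.linearIndependent_iff.1 extBasis.linearIndependent _ h1 k
        rw [h2, mul_zero]
    exact (mul_eq_zero.1 this).resolve_left hP
  rw [hφ]
  simp [hz]

theorem eq_of_ev_eq {φ ψ : A} (h : ∀ x, ev x φ = ev x ψ) : φ = ψ :=
  sub_eq_zero.1 <| eq_zero_of_ev_eq_zero _ 1 one_ne_zero fun x _ => by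
    rw [map_sub, h x, sub_self]

/-! ### The complexified group and its action on evaluations. -/

/-- The complexification of `K`: block diagonal matrices of determinant one. -/
def KC : Subgroup (Matrix.SpecialLinearGroup (Fin 3) ℂ) where
  carrier := {k | k.1 0 2 = 0 ∧ k.1 1 2 = 0 ∧ k.1 2 0 = 0 ∧ k.1 2 1 = 0}
  one_mem' := by simp
  mul_mem' := by
    rintro x y ⟨x1, x2, x3, x4⟩ ⟨y1, y2, y3, y4⟩
    simp [Matrix.mul_apply, Fin.sum_univ_three, *]
  inv_mem' := by
    rintro x ⟨x1, x2, x3, x4⟩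
    simp [Matrix.SpecialLinearGroup.coe_inv, Matrix.adjugate_fin_three, x1, x2, x3, x4]

theorem K_le_KC : K ≤ KC := fun _ hk => hk.2

theorem Ad_mem_p_of_mem_KC (k : KC) : ∀ X ∈ p, Ad k.1 X ∈ p := by
  intro X hX
  obtain ⟨k1, k2, k3, k4⟩ := k.2
  obtain ⟨l1, l2, l3, l4⟩ := (k⁻¹).2
  rw [mem_p_iff] at hX ⊢
  obtain ⟨h1, h2, h3, h4, h5⟩ := hX
  have key : (Ad k.1 X).1 = k.1.1 * X.1 * (k⁻¹).1.1 := rfl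
  rw [key]
  simp only [Matrix.mul_apply, Fin.sum_univ_three, k1, k2, k3, k4, l1, l2, l3, l4,
    h1, h2, h3, h4, h5]
  simp

/-- The adjoint action of the complexification of `K` on `𝔭`. -/
def adP (k : KC) : p →ₗ[ℂ] p := (Ad k.1).restrict (Ad_mem_p_of_mem_KC k)

/-- Pulling back the evaluation at a point along `k`. -/
def pull (x : Module.Dual ℂ g) (k : KC) : A →ₐ[ℂ] ExteriorAlgebra ℂ p :=
  (ExteriorAlgebra.map (adP k)).comp (ev (x ∘ₗ Ad k.1))

theorem pull_apply (x : Module.Dual ℂ g) (k : KC) (φ : A) :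
    pull x k φ = ExteriorAlgebra.map (adP k) (ev (x ∘ₗ Ad k.1) φ) := rfl

/-- Invariance under `k` thus reads `pull x k φ = ev x φ` for all `x`, a condition that also makes
sense for `k` in `KC`. -/
theorem ev_act (x : Module.Dual ℂ g) (k : K) (φ : A) :
    ev x (act k φ) = pull x ⟨k.1, K_le_KC k.2⟩ φ := by
  have h : (SymmetricAlgebra.lift x).comp
      (SymmetricAlgebra.lift ((SymmetricAlgebra.ι ℂ g).comp (Ad k.1))) =
      SymmetricAlgebra.lift (x ∘ₗ Ad k.1) := by
    apply SymmetricAlgebra.algHom_ext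
    apply LinearMap.ext
    intro X
    simp
  induction φ using TensorProduct.induction_on with
  | zero => simp
  | add u v hu hv => rw [map_add, map_add, map_add, hu, hv]
  | tmul y m =>
    rw [act, Algebra.TensorProduct.map_tmul, pull_apply, ev_tmul, ev_tmul, map_smul, ← h]
    rfl

theorem Ad_mul (k l : Matrix.SpecialLinearGroup (Fin 3) ℂ) : Ad (k * l) = Ad k ∘ₗ Ad l := by
  apply LinearMap.ext
  intro X
  apply Subtype.ext
  change (k * l).1 * X.1 * ((k * l)⁻¹).1 = k.1 * (l.1 * X.1 * (l⁻¹).1) * (k⁻¹).1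
  rw [mul_inv_rev, Matrix.SpecialLinearGroup.coe_mul, Matrix.SpecialLinearGroup.coe_mul]
  simp only [Matrix.mul_assoc]

theorem adP_mul (k l : KC) : adP (k * l) = adP k ∘ₗ adP l := by
  apply LinearMap.ext
  intro X
  apply Subtype.ext
  change Ad (k * l).1 X.1 = Ad k.1 (Ad l.1 X.1)
  rw [Subgroup.coe_mul, Ad_mul, LinearMap.comp_apply]

/-- The hypotheses range over all `x` because pulling back along `k` moves the point at which `l` is
applied. -/
theorem pull_mul_eq_ev {φ : A} {k l : KC} (hk : ∀ x, pull x k φ = ev x φ)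
    (hl : ∀ x, pull x l φ = ev x φ) (x : Module.Dual ℂ g) : pull x (k * l) φ = ev x φ := by
  calc pull x (k * l) φ = ExteriorAlgebra.map (adP k) (ExteriorAlgebra.map (adP l)
        (ev ((x ∘ₗ Ad k.1) ∘ₗ Ad l.1) φ)) := by
        rw [pull_apply, adP_mul, ← ExteriorAlgebra.map_comp_map, AlgHom.comp_apply,
          Subgroup.coe_mul, Ad_mul, ← LinearMap.comp_assoc]
    _ = ev x φ := by rw [← pull_apply, hl, ← pull_apply, hk]

/-! ### Laurent polynomials and the unitarian trick. -/

section Laurent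

variable {V W : Type} [AddCommGroup V] [Module ℂ V] [AddCommGroup W] [Module ℂ W]

variable (V) in
/-- The space of Laurent polynomial functions on `ℂˣ` with values in a vector space. -/
def laurent : Submodule ℂ (ℂˣ → V) :=
  Submodule.span ℂ {q | ∃ (n : ℤ) (v : V), q = fun z => ((z ^ n : ℂˣ) : ℂ) • v}

theorem monomial_mem_laurent (n : ℤ) (v : V) :
    (fun z : ℂˣ => ((z ^ n : ℂˣ) : ℂ) • v) ∈ laurent V :=
  Submodule.subset_span ⟨n, v, rfl⟩

theorem const_mem_laurent (v : V) : (fun _ : ℂˣ => v) ∈ laurent V := by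
  simpa using monomial_mem_laurent 0 v

theorem id_mem_laurent (v : V) : (fun z : ℂˣ => (z : ℂ) • v) ∈ laurent V := by
  simpa using monomial_mem_laurent 1 v

theorem inv_mem_laurent (v : V) : (fun z : ℂˣ => (z : ℂ)⁻¹ • v) ∈ laurent V := by
  simpa using monomial_mem_laurent (-1) v

theorem comp_mem_laurent (L : V →ₗ[ℂ] W) {q : ℂˣ → V} (hq : q ∈ laurent V) :
    (fun z => L (q z)) ∈ laurent W := by
  induction hq using Submodule.span_induction with
  | mem q hq =>
    obtain ⟨n, v, rfl⟩ := hq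
    simpa using monomial_mem_laurent n (L v)
  | zero => simpa using const_mem_laurent (0 : W)
  | add q r _ _ hq hr =>
    simp only [Pi.add_apply, map_add]
    exact add_mem hq hr
  | smul t q _ hq =>
    simp only [Pi.smul_apply, map_smul]
    exact Submodule.smul_mem (laurent W) t hq

theorem comp_inv_mem_laurent {q : ℂˣ → V} (hq : q ∈ laurent V) :
    (fun z => q z⁻¹) ∈ laurent V := by
  induction hq using Submodule.span_induction with
  | mem q hq =>
    obtain ⟨n, v, rfl⟩ := hq
    simpa using monomial_mem_laurent (-n) v
  | zero => exact zero_mem (laurent V)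
  | add q r _ _ hq hr => exact add_mem hq hr
  | smul t q _ hq => exact Submodule.smul_mem (laurent V) t hq

theorem mul_mem_laurent {R : Type} [Ring R] [Algebra ℂ R] {q r : ℂˣ → R} (hq : q ∈ laurent R)
    (hr : r ∈ laurent R) : q * r ∈ laurent R := by
  have h := Submodule.mul_mem_mul hq hr
  rw [laurent, Submodule.span_mul_span] at h
  refine Submodule.span_mono ?_ h
  rintro _ ⟨_, ⟨m, u, rfl⟩, _, ⟨n, v, rfl⟩, rfl⟩
  refine ⟨m + n, u * v, ?_⟩
  funext z
  simp [zpow_add, smul_smul, mul_comm]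

theorem exists_polynomial_of_mem_laurent {q : ℂˣ → ℂ} (hq : q ∈ laurent ℂ) :
    ∃ (N : ℕ) (P : Polynomial ℂ), ∀ z : ℂˣ, (z : ℂ) ^ N * q z = P.eval (z : ℂ) := by
  induction hq using Submodule.span_induction with
  | mem q hq =>
    obtain ⟨n, v, rfl⟩ := hq
    refine ⟨(-n).toNat, Polynomial.C v * Polynomial.X ^ n.toNat, fun z => ?_⟩
    have h : (z : ℂ) ^ (-n).toNat * (z : ℂ) ^ n = (z : ℂ) ^ n.toNat := by
      rw [← zpow_natCast, ← zpow_natCast, ← zpow_add₀ z.ne_zero]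
      congr 1
      omega
    simp only [Units.val_zpow_eq_zpow_val, smul_eq_mul, Polynomial.eval_mul, Polynomial.eval_C,
      Polynomial.eval_pow, Polynomial.eval_X]
    rw [← h]
    ring
  | zero => exact ⟨0, 0, by simp⟩
  | add q r _ _ hq hr =>
    obtain ⟨M, P, hP⟩ := hq
    obtain ⟨N, Q, hQ⟩ := hr
    refine ⟨M + N, Polynomial.X ^ N * P + Polynomial.X ^ M * Q, fun z => ?_⟩
    simp only [Pi.add_apply, Polynomial.eval_add, Polynomial.eval_mul, Polynomial.eval_pow,
      Polynomial.eval_X, ← hP, ← hQ]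
    ring
  | smul t q _ hq =>
    obtain ⟨M, P, hP⟩ := hq
    refine ⟨M, Polynomial.C t * P, fun z => ?_⟩
    simp only [Pi.smul_apply, smul_eq_mul, Polynomial.eval_mul, Polynomial.eval_C, ← hP]
    ring

theorem infinite_norm_eq_one : {z : ℂ | ‖z‖ = 1}.Infinite := by
  intro h
  have hpi : Real.pi = -Real.pi + 2 * Real.pi := by ring
  have h1 : (Set.Ioc (-Real.pi) Real.pi).Finite := by
    refine Set.Finite.of_finite_image (f := fun t : ℝ => Complex.exp (t * Complex.I))
      (h.subset ?_) ?_
    · rintro _ ⟨t, -, rfl⟩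
      exact Complex.norm_exp_ofReal_mul_I t
    · intro s hs t ht hst
      have := congrArg Complex.arg hst
      rwa [Complex.arg_exp_mul_I, Complex.arg_exp_mul_I,
        (toIocMod_eq_self Real.two_pi_pos).2 (hpi ▸ hs),
        (toIocMod_eq_self Real.two_pi_pos).2 (hpi ▸ ht)] at this
  exact (Set.Ioc_infinite (by linarith [Real.pi_pos])) h1

/-- After multiplication by a power of `z`, `q` becomes a polynomial with infinitely many roots on
the unit circle. -/
theorem eq_zero_of_mem_laurent {q : ℂˣ → ℂ} (hq : q ∈ laurent ℂ)
    (h : ∀ z : ℂˣ, ‖(z : ℂ)‖ = 1 → q z = 0) (z : ℂˣ) : q z = 0 := by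
  obtain ⟨N, P, hP⟩ := exists_polynomial_of_mem_laurent hq
  have hP0 : P = 0 := by
    apply Polynomial.eq_zero_of_infinite_isRoot
    refine infinite_norm_eq_one.mono fun t ht => ?_
    have ht0 : t ≠ 0 := by
      rintro rfl
      simp at ht
    have := hP (Units.mk0 t ht0)
    rw [h (Units.mk0 t ht0) ht, mul_zero] at this
    exact this.symm
  have h1 := hP z
  rw [hP0, Polynomial.eval_zero] at h1
  exact (mul_eq_zero.1 h1).resolve_left (pow_ne_zero _ z.ne_zero)

end Laurent

theorem Ad_mem_laurent {k : ℂˣ → KC} (hk : (fun z => (k z).1.1) ∈ laurent _)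
    (hinv : ∀ z, (k z)⁻¹ = k z⁻¹) (X : g) : (fun z => Ad (k z).1 X) ∈ laurent g := by
  let ι' : g →ₗ[ℂ] Matrix (Fin 3) (Fin 3) ℂ :=
    { toFun := fun X => X.1, map_add' := fun _ _ => rfl, map_smul' := fun _ _ => rfl }
  -- A linear retraction of matrices onto `𝔤` transfers the Laurent property from matrix-valued to
  -- `𝔤`-valued functions.
  obtain ⟨L, hL⟩ := LinearMap.exists_leftInverse_of_injective ι'
    (LinearMap.ker_eq_bot.2 Subtype.val_injective)
  have hk' : (fun z => ((k z)⁻¹).1.1) ∈ laurent _ := by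
    simp only [hinv]
    exact comp_inv_mem_laurent hk
  have h := comp_mem_laurent L (mul_mem_laurent (mul_mem_laurent hk (const_mem_laurent X.1)) hk')
  convert h using 2 with z
  exact (LinearMap.congr_fun hL (Ad (k z).1 X)).symm

theorem adP_mem_laurent {k : ℂˣ → KC} (hk : (fun z => (k z).1.1) ∈ laurent _)
    (hinv : ∀ z, (k z)⁻¹ = k z⁻¹) (X : p) : (fun z => adP (k z) X) ∈ laurent p := by
  obtain ⟨L, hL⟩ := LinearMap.exists_leftInverse_of_injective p.subtype
    (LinearMap.ker_eq_bot.2 Subtype.val_injective)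
  have h := comp_mem_laurent L (Ad_mem_laurent hk hinv X.1)
  convert h using 2 with z
  exact (LinearMap.congr_fun hL (adP (k z) X)).symm

theorem pull_mem_laurent {k : ℂˣ → KC} (hk : (fun z => (k z).1.1) ∈ laurent _)
    (hinv : ∀ z, (k z)⁻¹ = k z⁻¹) (x : Module.Dual ℂ g) (φ : A) :
    (fun z => pull x (k z) φ) ∈ laurent (ExteriorAlgebra ℂ p) := by
  have h1 (y : SymmetricAlgebra ℂ g) :
      (fun z => SymmetricAlgebra.lift (x ∘ₗ Ad (k z).1) y) ∈ laurent ℂ := by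
    induction y using SymmetricAlgebra.induction with
    | algebraMap r => simpa using const_mem_laurent r
    | ι X => simpa using comp_mem_laurent x (Ad_mem_laurent hk hinv X)
    | mul u v hu hv =>
      simp only [map_mul]
      exact mul_mem_laurent hu hv
    | add u v hu hv =>
      simp only [map_add]
      exact add_mem hu hv
  have h2 (m : ExteriorAlgebra ℂ p) :
      (fun z => ExteriorAlgebra.map (adP (k z)) m) ∈ laurent (ExteriorAlgebra ℂ p) := by
    induction m using ExteriorAlgebra.induction with
    | algebraMap r => simpa using const_mem_laurent (algebraMap ℂ (ExteriorAlgebra ℂ p) r)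
    | ι X => simpa using comp_mem_laurent (ExteriorAlgebra.ι ℂ) (adP_mem_laurent hk hinv X)
    | mul u v hu hv =>
      simp only [map_mul]
      exact mul_mem_laurent hu hv
    | add u v hu hv =>
      simp only [map_add]
      exact add_mem hu hv
  induction φ using TensorProduct.induction_on with
  | zero => simpa using const_mem_laurent (0 : ExteriorAlgebra ℂ p)
  | add u v hu hv =>
    simp only [map_add]
    exact add_mem hu hv
  | tmul y m =>
    have h := mul_mem_laurent
      (comp_mem_laurent (Algebra.linearMap ℂ (ExteriorAlgebra ℂ p)) (h1 y)) (h2 m)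
    convert h using 2 with z
    simp [pull_apply, ev_tmul, Algebra.smul_def]

/-- Unitarian trick for one parameter: the coordinates of the difference of the two sides are
Laurent polynomials in `z`, and vanish on the unit circle, where `k z` lies in `K`. -/
theorem pull_eq_ev_of_mem_laurent {k : ℂˣ → KC} (hk : (fun z => (k z).1.1) ∈ laurent _)
    (hinv : ∀ z, (k z)⁻¹ = k z⁻¹) (hK : ∀ z : ℂˣ, ‖(z : ℂ)‖ = 1 → (k z).1 ∈ K)
    {φ : A} (hφ : φ ∈ invariants) (z : ℂˣ) (x : Module.Dual ℂ g) :
    pull x (k z) φ = ev x φ := by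
  apply extBasis.ext_elem
  intro t
  rw [← sub_eq_zero]
  refine eq_zero_of_mem_laurent (q := fun z => extBasis.repr (pull x (k z) φ) t -
    extBasis.repr (ev x φ) t) ?_ ?_ z
  · exact sub_mem (comp_mem_laurent (extBasis.coord t) (pull_mem_laurent hk hinv x φ))
      (const_mem_laurent _)
  · intro z hz
    have h := ev_act x ⟨(k z).1, hK z hz⟩ φ
    rw [hφ] at h
    rw [h]
    exact sub_self _

/-! ### Block matrices as products of one-parameter families. -/

/-- A block diagonal matrix of determinant one, from its entries. -/
def blockKC (p q r t κ : ℂ) (h : (p * t - q * r) * κ = 1) : KC :=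
  ⟨⟨!![p, q, 0; r, t, 0; 0, 0, κ], by
    rw [Matrix.det_fin_three]
    simp
    linear_combination h⟩, ⟨by simp, by simp, by simp, by simp⟩⟩

theorem blockKC_val (p q r t κ : ℂ) (h : (p * t - q * r) * κ = 1) :
    (blockKC p q r t κ h).1.1 = !![p, q, 0; r, t, 0; 0, 0, κ] := rfl

theorem blockKC_inv (p q r t κ : ℂ) (h : (p * t - q * r) * κ = 1) :
    (blockKC p q r t κ h)⁻¹.1.1 =
      !![t * κ, -q * κ, 0; -r * κ, p * κ, 0; 0, 0, p * t - q * r] := by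
  change ((blockKC p q r t κ h).1⁻¹).1 = _
  rw [Matrix.SpecialLinearGroup.coe_inv, blockKC_val, Matrix.adjugate_fin_three]
  ext m n
  fin_cases m <;> fin_cases n <;> simp

theorem exists_eq_blockKC (k : KC) : ∃ p q r t κ h, k = blockKC p q r t κ h := by
  obtain ⟨h1, h2, h3, h4⟩ := k.2
  refine ⟨k.1.1 0 0, k.1.1 0 1, k.1.1 1 0, k.1.1 1 1, k.1.1 2 2, ?_, ?_⟩
  · have := k.1.2
    rw [Matrix.det_fin_three, h1, h2, h3, h4] at this
    linear_combination this
  · apply Subtype.ext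
    apply Subtype.ext
    rw [blockKC_val]
    ext m n
    fin_cases m <;> fin_cases n <;> simp [h1, h2, h3, h4]

theorem blockKC_mul (p q r t κ p' q' r' t' κ' : ℂ) (h : (p * t - q * r) * κ = 1)
    (h' : (p' * t' - q' * r') * κ' = 1) :
    blockKC p q r t κ h * blockKC p' q' r' t' κ' h' =
      blockKC (p * p' + q * r') (p * q' + q * t') (r * p' + t * r') (r * q' + t * t') (κ * κ')
        (by linear_combination h' + h * (p' * t' - q' * r') * κ') := by
  apply Subtype.ext
  apply Subtype.ext
  change (blockKC p q r t κ h).1.1 * (blockKC p' q' r' t' κ' h').1.1 = _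
  rw [blockKC_val, blockKC_val, blockKC_val]
  ext m n
  fin_cases m <;> fin_cases n <;> simp [Matrix.mul_apply, Fin.sum_univ_three]

theorem blockKC_congr {p q r t κ p' q' r' t' κ' : ℂ} (h : (p * t - q * r) * κ = 1)
    (h1 : p = p') (h2 : q = q') (h3 : r = r') (h4 : t = t') (h5 : κ = κ') :
    blockKC p q r t κ h = blockKC p' q' r' t' κ' (by subst_vars; exact h) := by
  subst_vars
  rfl

theorem blockKC_mem_K {p q r t κ : ℂ} (h : (p * t - q * r) * κ = 1)
    (h1 : star p * p + star r * r = 1) (h2 : star p * q + star r * t = 0)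
    (h3 : star q * p + star t * r = 0) (h4 : star q * q + star t * t = 1)
    (h5 : star κ * κ = 1) : (blockKC p q r t κ h).1 ∈ K := by
  refine ⟨?_, (blockKC p q r t κ h).2⟩
  rw [blockKC_val]
  simp only [RCLike.star_def] at *
  ext m n
  fin_cases m <;> fin_cases n <;>
    simp [Matrix.mul_apply, Fin.sum_univ_three, Matrix.conjTranspose_apply, *]

theorem blockKC_inv_eq {p q r t κ p' q' r' t' κ' : ℂ} (h : (p * t - q * r) * κ = 1)
    (h' : (p' * t' - q' * r') * κ' = 1) (h1 : t * κ = p') (h2 : -q * κ = q') (h3 : -r * κ = r')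
    (h4 : p * κ = t') (h5 : p * t - q * r = κ') :
    (blockKC p q r t κ h)⁻¹ = blockKC p' q' r' t' κ' h' := by
  apply Subtype.ext
  apply Subtype.ext
  rw [blockKC_inv, blockKC_val, h1, h2, h3, h4, h5]

theorem star_eq_inv {z : ℂˣ} (hz : ‖(z : ℂ)‖ = 1) : star (z : ℂ) = (z : ℂ)⁻¹ := by
  rw [RCLike.star_def, Complex.inv_def, Complex.normSq_eq_norm_sq, hz]
  simp

theorem pull_diag_left {φ : A} (hφ : φ ∈ invariants) (z : ℂˣ) (x : Module.Dual ℂ g) :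
    pull x (blockKC z 0 0 1 (z : ℂ)⁻¹ (by simp)) φ = ev x φ := by
  refine pull_eq_ev_of_mem_laurent (k := fun z => blockKC z 0 0 1 (z : ℂ)⁻¹ (by simp))
    ?_ ?_ ?_ hφ z x
  · have h := add_mem (add_mem (id_mem_laurent (!![1, 0, 0; 0, 0, 0; 0, 0, 0] : Matrix _ _ ℂ))
      (inv_mem_laurent (!![0, 0, 0; 0, 0, 0; 0, 0, 1] : Matrix _ _ ℂ)))
      (const_mem_laurent (!![0, 0, 0; 0, 1, 0; 0, 0, 0] : Matrix _ _ ℂ))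
    convert h using 2 with z
    ext m n
    fin_cases m <;> fin_cases n <;> simp [blockKC_val]
  · intro z
    apply blockKC_inv_eq <;> simp
  · intro z hz
    have := star_eq_inv hz
    apply blockKC_mem_K <;> simp_all

theorem pull_diag_right {φ : A} (hφ : φ ∈ invariants) (z : ℂˣ) (x : Module.Dual ℂ g) :
    pull x (blockKC 1 0 0 z (z : ℂ)⁻¹ (by simp)) φ = ev x φ := by
  refine pull_eq_ev_of_mem_laurent (k := fun z => blockKC 1 0 0 z (z : ℂ)⁻¹ (by simp))
    ?_ ?_ ?_ hφ z x
  · have h := add_mem (add_mem (id_mem_laurent (!![0, 0, 0; 0, 1, 0; 0, 0, 0] : Matrix _ _ ℂ))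
      (inv_mem_laurent (!![0, 0, 0; 0, 0, 0; 0, 0, 1] : Matrix _ _ ℂ)))
      (const_mem_laurent (!![1, 0, 0; 0, 0, 0; 0, 0, 0] : Matrix _ _ ℂ))
    convert h using 2 with z
    ext m n
    fin_cases m <;> fin_cases n <;> simp [blockKC_val]
  · intro z
    apply blockKC_inv_eq <;> simp
  · intro z hz
    have := star_eq_inv hz
    apply blockKC_mem_K <;> simp_all

/-- For `z = exp(iθ)` the four entries are `cos θ, -sin θ, sin θ, cos θ`: this is the rotation
group, parametrised by Laurent polynomials. -/
theorem rotation_det (z : ℂˣ) : ((((z : ℂ) + (z : ℂ)⁻¹) / 2) * (((z : ℂ) + (z : ℂ)⁻¹) / 2) -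
    ((z : ℂ) - (z : ℂ)⁻¹) / 2 * Complex.I * (-(((z : ℂ) - (z : ℂ)⁻¹) / 2 * Complex.I))) * 1 =
      1 := by
  have hz := mul_inv_cancel₀ z.ne_zero
  linear_combination hz + (((z : ℂ) - (z : ℂ)⁻¹) / 2) ^ 2 * Complex.I_sq

theorem pull_rotation {φ : A} (hφ : φ ∈ invariants) (z : ℂˣ) (x : Module.Dual ℂ g) :
    pull x (blockKC _ _ _ _ _ (rotation_det z)) φ = ev x φ := by
  refine pull_eq_ev_of_mem_laurent (k := fun z => blockKC _ _ _ _ _ (rotation_det z))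
    ?_ ?_ ?_ hφ z x
  · have h := add_mem (add_mem
      (id_mem_laurent (!![1 / 2, Complex.I / 2, 0; -(Complex.I / 2), 1 / 2, 0; 0, 0, 0] :
        Matrix _ _ ℂ))
      (inv_mem_laurent (!![1 / 2, -(Complex.I / 2), 0; Complex.I / 2, 1 / 2, 0; 0, 0, 0] :
        Matrix _ _ ℂ)))
      (const_mem_laurent (!![0, 0, 0; 0, 0, 0; 0, 0, 1] : Matrix _ _ ℂ))
    convert h using 2 with z
    ext m n
    fin_cases m <;> fin_cases n <;> simp [blockKC_val] <;> ring
  · intro z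
    apply blockKC_inv_eq
    · simp; ring
    · simp; ring
    · simp; ring
    · simp; ring
    · simpa using rotation_det z
  · intro z hz
    have h1 := star_eq_inv hz
    have hz1 := mul_inv_cancel₀ z.ne_zero
    rw [RCLike.star_def] at h1
    have hI := Complex.I_sq
    apply blockKC_mem_K <;> simp [h1] <;> ring_nf <;> rw [hI] <;> field_simp <;> ring

/-- The 2 × 2 block factors as `diag(s₁, s₂)`, a complex rotation with cosine `C` and sine `S`, and
`diag(s₃, 1)`. Matching entries forces `C² = ptκ` and `S² = -qrκ`, whose sum is 1 by the determinant
condition. The nonvanishing of the entries permits the divisions defining the `sᵢ`. -/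
theorem pull_blockKC_eq_ev {φ : A} (hφ : φ ∈ invariants) {p q r t κ : ℂ}
    (h : (p * t - q * r) * κ = 1) (hp : p ≠ 0) (hq : q ≠ 0) (hr : r ≠ 0) (ht : t ≠ 0)
    (x : Module.Dual ℂ g) : pull x (blockKC p q r t κ h) φ = ev x φ := by
  have hκ : κ ≠ 0 := right_ne_zero_of_mul_eq_one h
  obtain ⟨C, hC⟩ := IsAlgClosed.exists_pow_nat_eq (p * t * κ) two_pos
  obtain ⟨S, hS⟩ := IsAlgClosed.exists_pow_nat_eq (-(q * r * κ)) two_pos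
  have hC0 : C ≠ 0 := by
    rintro rfl
    rw [zero_pow two_ne_zero] at hC
    exact mul_ne_zero (mul_ne_zero hp ht) hκ hC.symm
  have hS0 : S ≠ 0 := by
    rintro rfl
    rw [zero_pow two_ne_zero] at hS
    exact neg_ne_zero.2 (mul_ne_zero (mul_ne_zero hq hr) hκ) hS.symm
  have hCS : (C + S * Complex.I) * (C - S * Complex.I) = 1 := by
    linear_combination hC + hS + h - S ^ 2 * Complex.I_sq
  let z : ℂˣ := ⟨C + S * Complex.I, C - S * Complex.I, hCS, by rw [mul_comm]; exact hCS⟩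
  have hz : (z : ℂ) = C + S * Complex.I := rfl
  have hz' : (z : ℂ)⁻¹ = C - S * Complex.I := by
    rw [← Units.val_inv_eq_inv_val]
    rfl
  have e1 : ((z : ℂ) + (z : ℂ)⁻¹) / 2 = C := by rw [hz', hz]; ring
  have e2 : ((z : ℂ) - (z : ℂ)⁻¹) / 2 * Complex.I = -S := by
    rw [hz', hz]
    linear_combination S * Complex.I_sq
  let s₁ : ℂˣ := Units.mk0 (-q / S) (div_ne_zero (neg_ne_zero.2 hq) hS0)
  let s₂ : ℂˣ := Units.mk0 (t / C) (div_ne_zero ht hC0)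
  let s₃ : ℂˣ := Units.mk0 (r * C / (t * S)) (div_ne_zero (mul_ne_zero hr hC0) (mul_ne_zero ht hS0))
  have hfac : blockKC p q r t κ h = blockKC s₁ 0 0 1 (s₁ : ℂ)⁻¹ (by simp) *
      blockKC 1 0 0 s₂ (s₂ : ℂ)⁻¹ (by simp) * blockKC _ _ _ _ _ (rotation_det z) *
      blockKC s₃ 0 0 1 (s₃ : ℂ)⁻¹ (by simp) := by
    rw [blockKC_mul, blockKC_mul, blockKC_mul]
    apply blockKC_congr
    · rw [e1, e2]
      simp only [s₁, s₂, s₃, Units.val_mk0]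
      field_simp
      linear_combination p * t * hS + q * r * hC
    · rw [e1, e2]
      simp only [s₁, s₂, s₃, Units.val_mk0]
      field_simp
      ring
    · rw [e1, e2]
      simp only [s₁, s₂, s₃, Units.val_mk0]
      field_simp
      ring
    · rw [e1, e2]
      simp only [s₁, s₂, s₃, Units.val_mk0]
      field_simp
      ring
    · simp only [s₁, s₂, s₃, Units.val_mk0]
      field_simp
      linear_combination hS
  rw [hfac]
  exact pull_mul_eq_ev (pull_mul_eq_ev (pull_mul_eq_ev (pull_diag_left hφ s₁)
    (pull_diag_right hφ s₂)) (pull_rotation hφ z)) (pull_diag_left hφ s₃) x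

/-! ### Explicit adjoint action and invariance of the generators. -/

theorem E_val : E.1 = !![0, 1, 0; 0, 0, 0; 0, 0, 0] := by
  ext m n
  fin_cases m <;> fin_cases n <;> simp [E]

theorem F_val : F.1 = !![0, 0, 0; 1, 0, 0; 0, 0, 0] := by
  ext m n
  fin_cases m <;> fin_cases n <;> simp [F]

theorem E₁_val : E₁.1 = !![0, 0, 1; 0, 0, 0; 0, 0, 0] := by
  ext m n
  fin_cases m <;> fin_cases n <;> simp [E₁]

theorem E₂_val : E₂.1 = !![0, 0, 0; 0, 0, 1; 0, 0, 0] := by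
  ext m n
  fin_cases m <;> fin_cases n <;> simp [E₂]

theorem F₁_val : F₁.1 = !![0, 0, 0; 0, 0, 0; 1, 0, 0] := by
  ext m n
  fin_cases m <;> fin_cases n <;> simp [F₁]

theorem F₂_val : F₂.1 = !![0, 0, 0; 0, 0, 0; 0, 1, 0] := by
  ext m n
  fin_cases m <;> fin_cases n <;> simp [F₂]

theorem H_val : H.1 = !![1, 0, 0; 0, -1, 0; 0, 0, 0] := by
  ext m n
  fin_cases m <;> fin_cases n <;> simp [H, H₁, H₂] <;> norm_num

theorem H₁_add_H₂_val : (H₁ + H₂).1 = !![1 / 3, 0, 0; 0, 1 / 3, 0; 0, 0, -2 / 3] := by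
  ext m n
  fin_cases m <;> fin_cases n <;> simp [H₁, H₂] <;> norm_num

section Ad

variable (p q r t κ : ℂ) (h : (p * t - q * r) * κ = 1)

theorem Ad_blockKC_apply (X : g) : (Ad (blockKC p q r t κ h).1 X).1 =
    !![p, q, 0; r, t, 0; 0, 0, κ] * X.1 *
      !![t * κ, -q * κ, 0; -r * κ, p * κ, 0; 0, 0, p * t - q * r] := by
  rw [← blockKC_inv p q r t κ h]
  rfl

theorem Ad_E₁ : Ad (blockKC p q r t κ h).1 E₁ =
    ((p * t - q * r) * p) • E₁ + ((p * t - q * r) * r) • E₂ := by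
  apply Subtype.ext
  rw [Ad_blockKC_apply]
  ext m n
  fin_cases m <;> fin_cases n <;>
    simp [E₁_val, E₂_val, Matrix.mul_apply, Fin.sum_univ_three] <;> ring

theorem Ad_E₂ : Ad (blockKC p q r t κ h).1 E₂ =
    ((p * t - q * r) * q) • E₁ + ((p * t - q * r) * t) • E₂ := by
  apply Subtype.ext
  rw [Ad_blockKC_apply]
  ext m n
  fin_cases m <;> fin_cases n <;>
    simp [E₁_val, E₂_val, Matrix.mul_apply, Fin.sum_univ_three] <;> ring

theorem Ad_F₁ : Ad (blockKC p q r t κ h).1 F₁ = (κ ^ 2 * t) • F₁ - (κ ^ 2 * q) • F₂ := by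
  apply Subtype.ext
  rw [Ad_blockKC_apply]
  ext m n
  fin_cases m <;> fin_cases n <;>
    simp [F₁_val, F₂_val, Matrix.mul_apply, Fin.sum_univ_three] <;> ring

theorem Ad_F₂ : Ad (blockKC p q r t κ h).1 F₂ = (κ ^ 2 * p) • F₂ - (κ ^ 2 * r) • F₁ := by
  apply Subtype.ext
  rw [Ad_blockKC_apply]
  ext m n
  fin_cases m <;> fin_cases n <;>
    simp [F₁_val, F₂_val, Matrix.mul_apply, Fin.sum_univ_three] <;> ring

theorem Ad_E : Ad (blockKC p q r t κ h).1 E =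
    (κ * p ^ 2) • E - (κ * r ^ 2) • F - (κ * p * r) • H := by
  apply Subtype.ext
  rw [Ad_blockKC_apply]
  ext m n
  fin_cases m <;> fin_cases n <;>
    simp [E_val, F_val, H_val, Matrix.mul_apply, Fin.sum_univ_three] <;> ring

theorem Ad_F : Ad (blockKC p q r t κ h).1 F =
    (κ * q * t) • H - (κ * q ^ 2) • E + (κ * t ^ 2) • F := by
  apply Subtype.ext
  rw [Ad_blockKC_apply]
  ext m n
  fin_cases m <;> fin_cases n <;>
    simp [E_val, F_val, H_val, Matrix.mul_apply, Fin.sum_univ_three] <;> ring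

theorem Ad_H : Ad (blockKC p q r t κ h).1 H =
    (κ * (p * t + q * r)) • H - (2 * κ * p * q) • E + (2 * κ * r * t) • F := by
  apply Subtype.ext
  rw [Ad_blockKC_apply]
  ext m n
  fin_cases m <;> fin_cases n <;>
    simp [E_val, F_val, H_val, Matrix.mul_apply, Fin.sum_univ_three] <;> ring

theorem Ad_H₁_add_H₂ : Ad (blockKC p q r t κ h).1 (H₁ + H₂) = H₁ + H₂ := by
  apply Subtype.ext
  rw [Ad_blockKC_apply]
  ext m n
  fin_cases m <;> fin_cases n <;>
    simp [H₁_add_H₂_val, Matrix.mul_apply, Fin.sum_univ_three] <;>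
    first | linear_combination (1 / 3 : ℂ) * h | linear_combination (-2 / 3 : ℂ) * h | ring1

end Ad

/-- Unitarity is not needed for invariance of the generators: it follows from polynomial identities
modulo the determinant relation. -/
theorem mem_invariants_of_pull {φ : A} (hφ : ∀ (x : Module.Dual ℂ g) (p q r t κ : ℂ)
    (h : (p * t - q * r) * κ = 1), pull x (blockKC p q r t κ h) φ = ev x φ) :
    φ ∈ invariants := by
  intro k
  apply eq_of_ev_eq
  intro x
  obtain ⟨p, q, r, t, κ, h, hk⟩ := exists_eq_blockKC ⟨k.1, K_le_KC k.2⟩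
  rw [ev_act, hk, hφ]

section invariance

variable (x : Module.Dual ℂ g) (p q r t κ : ℂ) (h : (p * t - q * r) * κ = 1)

theorem map_adP_εE₁ : ExteriorAlgebra.map (adP (blockKC p q r t κ h)) εE₁ =
    ((p * t - q * r) * p) • εE₁ + ((p * t - q * r) * r) • εE₂ := by
  rw [εE₁, εE₂, ExteriorAlgebra.map_apply_ι, ← map_smul, ← map_smul, ← map_add]
  exact congrArg _ (Subtype.ext (Ad_E₁ p q r t κ h))

theorem map_adP_εE₂ : ExteriorAlgebra.map (adP (blockKC p q r t κ h)) εE₂ =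
    ((p * t - q * r) * q) • εE₁ + ((p * t - q * r) * t) • εE₂ := by
  rw [εE₁, εE₂, ExteriorAlgebra.map_apply_ι, ← map_smul, ← map_smul, ← map_add]
  exact congrArg _ (Subtype.ext (Ad_E₂ p q r t κ h))

theorem map_adP_εF₁ : ExteriorAlgebra.map (adP (blockKC p q r t κ h)) εF₁ =
    (κ ^ 2 * t) • εF₁ - (κ ^ 2 * q) • εF₂ := by
  rw [εF₁, εF₂, ExteriorAlgebra.map_apply_ι, ← map_smul, ← map_smul, ← map_sub]
  exact congrArg _ (Subtype.ext (Ad_F₁ p q r t κ h))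

theorem map_adP_εF₂ : ExteriorAlgebra.map (adP (blockKC p q r t κ h)) εF₂ =
    (κ ^ 2 * p) • εF₂ - (κ ^ 2 * r) • εF₁ := by
  rw [εF₁, εF₂, ExteriorAlgebra.map_apply_ι, ← map_smul, ← map_smul, ← map_sub]
  exact congrArg _ (Subtype.ext (Ad_F₂ p q r t κ h))

theorem comp_Ad : (x ∘ₗ Ad (blockKC p q r t κ h).1) (H₁ + H₂) = x (H₁ + H₂) ∧
    (x ∘ₗ Ad (blockKC p q r t κ h).1) H =
      κ * (p * t + q * r) * x H - 2 * κ * p * q * x E + 2 * κ * r * t * x F ∧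
    (x ∘ₗ Ad (blockKC p q r t κ h).1) E =
      κ * p ^ 2 * x E - κ * r ^ 2 * x F - κ * p * r * x H ∧
    (x ∘ₗ Ad (blockKC p q r t κ h).1) F =
      κ * q * t * x H - κ * q ^ 2 * x E + κ * t ^ 2 * x F ∧
    (x ∘ₗ Ad (blockKC p q r t κ h).1) E₁ =
      (p * t - q * r) * p * x E₁ + (p * t - q * r) * r * x E₂ ∧
    (x ∘ₗ Ad (blockKC p q r t κ h).1) E₂ =
      (p * t - q * r) * q * x E₁ + (p * t - q * r) * t * x E₂ ∧
    (x ∘ₗ Ad (blockKC p q r t κ h).1) F₁ = κ ^ 2 * t * x F₁ - κ ^ 2 * q * x F₂ ∧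
    (x ∘ₗ Ad (blockKC p q r t κ h).1) F₂ = κ ^ 2 * p * x F₂ - κ ^ 2 * r * x F₁ := by
  refine ⟨?_, ?_, ?_, ?_, ?_, ?_, ?_, ?_⟩ <;> rw [LinearMap.comp_apply]
  · rw [Ad_H₁_add_H₂]
  · rw [Ad_H]; simp only [map_add, map_sub, map_smul, smul_eq_mul]
  · rw [Ad_E]; simp only [map_add, map_sub, map_smul, smul_eq_mul]
  · rw [Ad_F]; simp only [map_add, map_sub, map_smul, smul_eq_mul]
  · rw [Ad_E₁]; simp only [map_add, map_sub, map_smul, smul_eq_mul]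
  · rw [Ad_E₂]; simp only [map_add, map_sub, map_smul, smul_eq_mul]
  · rw [Ad_F₁]; simp only [map_add, map_sub, map_smul, smul_eq_mul]
  · rw [Ad_F₂]; simp only [map_add, map_sub, map_smul, smul_eq_mul]

theorem pull_a : pull x (blockKC p q r t κ h) a = ev x a := by
  rw [pull_apply, ev_a, ev_a, AlgHom.commutes, (comp_Ad x p q r t κ h).1]

theorem pull_b : pull x (blockKC p q r t κ h) b = ev x b := by
  obtain ⟨-, hH, hE, hF, -⟩ := comp_Ad x p q r t κ h
  rw [pull_apply, ev_b, ev_b, AlgHom.commutes, hH, hE, hF]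
  congr 1
  -- The transformed value is the old one times `u²` with `u = (pt - qr)κ`, and `u² - 1 = (u + 1)(u
  -- - 1)`. The other generators likewise acquire a factor `u²` or `u³`, the latter giving the
  -- cofactor `u² + u + 1`.
  linear_combination (x H ^ 2 + 4 * x E * x F) * ((p * t - q * r) * κ + 1) * h

theorem pull_c : pull x (blockKC p q r t κ h) c = ev x c := by
  obtain ⟨-, -, -, -, hE₁, hE₂, hF₁, hF₂⟩ := comp_Ad x p q r t κ h
  rw [pull_apply, ev_c, ev_c, AlgHom.commutes, hE₁, hE₂, hF₁, hF₂]
  congr 1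
  linear_combination (x E₁ * x F₁ + x E₂ * x F₂) * ((p * t - q * r) * κ + 1) * h

theorem pull_d : pull x (blockKC p q r t κ h) d = ev x d := by
  obtain ⟨-, hH, hE, hF, hE₁, hE₂, hF₁, hF₂⟩ := comp_Ad x p q r t κ h
  rw [pull_apply, ev_d, ev_d, AlgHom.commutes, hH, hE, hF, hE₁, hE₂, hF₁, hF₂]
  congr 1
  linear_combination (2 * x E * x E₂ * x F₁ + x H * x E₁ * x F₁ - x H * x E₂ * x F₂ +
    2 * x F * x E₁ * x F₂) * (((p * t - q * r) * κ) ^ 2 + (p * t - q * r) * κ + 1) * h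

theorem pull_e : pull x (blockKC p q r t κ h) e = ev x e := by
  obtain ⟨-, hH, hE, hF, hE₁, hE₂, hF₁, hF₂⟩ := comp_Ad x p q r t κ h
  rw [pull_apply, ev_e, ev_e, map_add, map_smul, map_smul, map_adP_εE₁, map_adP_εE₂, hF₁, hF₂]
  match_scalars
  · linear_combination x F₁ * ((p * t - q * r) * κ + 1) * h
  · linear_combination x F₂ * ((p * t - q * r) * κ + 1) * h

theorem pull_f : pull x (blockKC p q r t κ h) f = ev x f := by
  obtain ⟨-, hH, hE, hF, hE₁, hE₂, hF₁, hF₂⟩ := comp_Ad x p q r t κ h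
  rw [pull_apply, ev_f, ev_f, map_add, map_smul, map_smul, map_adP_εF₁, map_adP_εF₂, hE₁, hE₂]
  match_scalars
  · linear_combination x E₁ * ((p * t - q * r) * κ + 1) * h
  · linear_combination x E₂ * ((p * t - q * r) * κ + 1) * h

theorem pull_h : pull x (blockKC p q r t κ h) SU21.h = ev x SU21.h := by
  obtain ⟨-, hH, hE, hF, hE₁, hE₂, hF₁, hF₂⟩ := comp_Ad x p q r t κ h
  rw [pull_apply, ev_h, ev_h, map_add, map_smul, map_smul, map_adP_εF₁, map_adP_εF₂, hE₁, hE₂,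
    hH, hE, hF]
  match_scalars
  · linear_combination (2 * x E * x E₂ + x H * x E₁) *
      (((p * t - q * r) * κ) ^ 2 + (p * t - q * r) * κ + 1) * h
  · linear_combination (-(x H * x E₂) + 2 * x F * x E₁) *
      (((p * t - q * r) * κ) ^ 2 + (p * t - q * r) * κ + 1) * h

theorem pull_j : pull x (blockKC p q r t κ h) j = ev x j := by
  obtain ⟨-, hH, hE, hF, hE₁, hE₂, hF₁, hF₂⟩ := comp_Ad x p q r t κ h
  rw [pull_apply, ev_j, ev_j, map_add, map_smul, map_smul, map_adP_εE₁, map_adP_εE₂, hF₁, hF₂,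
    hH, hE, hF]
  match_scalars
  · linear_combination (x H * x F₁ + 2 * x F * x F₂) *
      (((p * t - q * r) * κ) ^ 2 + (p * t - q * r) * κ + 1) * h
  · linear_combination (2 * x E * x F₁ - x H * x F₂) *
      (((p * t - q * r) * κ) ^ 2 + (p * t - q * r) * κ + 1) * h

theorem pull_gg : pull x (blockKC p q r t κ h) gg = ev x gg := by
  rw [pull_apply, ev_gg, ev_gg, map_add, map_mul, map_mul, map_adP_εE₁, map_adP_εE₂,
    map_adP_εF₁, map_adP_εF₂]
  simp only [add_mul, mul_sub, smul_mul_assoc, mul_smul_comm]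
  match_scalars
  · linear_combination ((p * t - q * r) * κ + 1) * h
  · ring
  · ring
  · linear_combination ((p * t - q * r) * κ + 1) * h

theorem pull_i : pull x (blockKC p q r t κ h) i = ev x i := by
  obtain ⟨-, hH, hE, hF, -⟩ := comp_Ad x p q r t κ h
  rw [pull_apply, ev_i, ev_i]
  simp only [map_add, map_sub, map_smul, map_mul, map_adP_εE₁, map_adP_εE₂,
    map_adP_εF₁, map_adP_εF₂, hH, hE, hF]
  simp only [add_mul, mul_sub, smul_mul_assoc, mul_smul_comm]
  match_scalars
  · linear_combination x H * (((p * t - q * r) * κ) ^ 2 + (p * t - q * r) * κ + 1) * h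
  · linear_combination 2 * x E * (((p * t - q * r) * κ) ^ 2 + (p * t - q * r) * κ + 1) * h
  · linear_combination 2 * x F * (((p * t - q * r) * κ) ^ 2 + (p * t - q * r) * κ + 1) * h
  · linear_combination -x H * (((p * t - q * r) * κ) ^ 2 + (p * t - q * r) * κ + 1) * h

end invariance

theorem monom_mem (n : Fin 4 → ℕ) : monom n ∈ invariants :=
  mul_mem (mul_mem (mul_mem (pow_mem (mem_invariants_of_pull pull_a) _)
    (pow_mem (mem_invariants_of_pull pull_b) _)) (pow_mem (mem_invariants_of_pull pull_c) _))
    (pow_mem (mem_invariants_of_pull pull_d) _)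

theorem tElem_mem (t : Fin 16) : tElem t ∈ invariants := by
  have he := mem_invariants_of_pull pull_e
  have hf := mem_invariants_of_pull pull_f
  have hg := mem_invariants_of_pull pull_gg
  have hh := mem_invariants_of_pull pull_h
  have hi := mem_invariants_of_pull pull_i
  have hj := mem_invariants_of_pull pull_j
  fin_cases t
  exacts [one_mem _, he, hf, hg, hh, hi, hj, mul_mem he hf, mul_mem he hg, mul_mem hf hg,
    pow_mem hg 2, mul_mem he hi, mul_mem he hj, mul_mem hf hh, mul_mem hf hi, mul_mem hf hj]

/-! ### The two slices and conjugation to `sliceF`. -/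

theorem val_add (X Y : g) : (X + Y).1 = X.1 + Y.1 := rfl

theorem val_smul (r : ℂ) (X : g) : (r • X).1 = r • X.1 := rfl

/-- The point of the dual of `𝔤` with prescribed values on
`H₁ + H₂, H, E, F, E₁, E₂, F₁, F₂`. -/
def dualPt (α η ε φ v₁ v₂ w₁ w₂ : ℂ) : Module.Dual ℂ g where
  toFun X := α * (-3 / 2 * X.1 2 2) + η * ((X.1 0 0 - X.1 1 1) / 2) + ε * X.1 0 1 + φ * X.1 1 0 +
    v₁ * X.1 0 2 + v₂ * X.1 1 2 + w₁ * X.1 2 0 + w₂ * X.1 2 1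
  map_add' X Y := by
    simp only [val_add, Matrix.add_apply]
    ring
  map_smul' r X := by
    simp only [val_smul, Matrix.smul_apply, smul_eq_mul, RingHom.id_apply]
    ring

theorem dualPt_apply (α η ε φ v₁ v₂ w₁ w₂ : ℂ) :
    dualPt α η ε φ v₁ v₂ w₁ w₂ (H₁ + H₂) = α ∧ dualPt α η ε φ v₁ v₂ w₁ w₂ H = η ∧
    dualPt α η ε φ v₁ v₂ w₁ w₂ E = ε ∧ dualPt α η ε φ v₁ v₂ w₁ w₂ F = φ ∧
    dualPt α η ε φ v₁ v₂ w₁ w₂ E₁ = v₁ ∧ dualPt α η ε φ v₁ v₂ w₁ w₂ E₂ = v₂ ∧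
    dualPt α η ε φ v₁ v₂ w₁ w₂ F₁ = w₁ ∧ dualPt α η ε φ v₁ v₂ w₁ w₂ F₂ = w₂ := by
  refine ⟨?_, ?_, ?_, ?_, ?_, ?_, ?_, ?_⟩ <;>
    simp only [dualPt, LinearMap.coe_mk, AddHom.coe_mk, H₁_add_H₂_val, H_val, E_val, F_val,
      E₁_val, E₂_val, F₁_val, F₂_val] <;> simp
  ring

theorem dual_ext {x y : Module.Dual ℂ g} (h0 : x (H₁ + H₂) = y (H₁ + H₂)) (h1 : x H = y H)
    (h2 : x E = y E) (h3 : x F = y F) (h4 : x E₁ = y E₁) (h5 : x E₂ = y E₂) (h6 : x F₁ = y F₁)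
    (h7 : x F₂ = y F₂) : x = y := by
  apply LinearMap.ext
  intro X
  have htr : X.1 2 2 = -X.1 0 0 - X.1 1 1 := by
    have h : Matrix.trace X.1 = 0 := X.2
    rw [Matrix.trace_fin_three] at h
    linear_combination h
  have hX : X = (-3 / 2 * X.1 2 2) • (H₁ + H₂) + ((X.1 0 0 - X.1 1 1) / 2) • H + X.1 0 1 • E +
      X.1 1 0 • F + X.1 0 2 • E₁ + X.1 1 2 • E₂ + X.1 2 0 • F₁ + X.1 2 1 • F₂ := by
    apply Subtype.ext
    simp only [val_add, val_smul, H_val, E_val, F_val,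
      E₁_val, E₂_val, F₁_val, F₂_val]
    rw [← val_add, H₁_add_H₂_val]
    ext m n
    fin_cases m <;> fin_cases n <;> simp [htr] <;> ring
  rw [hX]
  simp only [map_add _ (_ • _), map_add _ (_ + _ • _), map_smul, h0, h1, h2, h3, h4, h5, h6, h7]

/-- The values of `a, b, c, d` at a point. -/
def invVal (x : Module.Dual ℂ g) : Fin 4 → ℂ :=
  ![x (H₁ + H₂), x H ^ 2 + 4 * x E * x F, x E₁ * x F₁ + x E₂ * x F₂,
    2 * x E * x E₂ * x F₁ + x H * x E₁ * x F₁ - x H * x E₂ * x F₂ + 2 * x F * x E₁ * x F₂]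

/-- The slice on which `(F₁, F₂)` is the first basis vector. -/
def sliceF (r : Fin 4 → ℂ) : Module.Dual ℂ g := dualPt (r 0) 0 (1 / 2) (r 1 / 2) (r 2) (r 3) 1 0

/-- The slice on which `(E₁, E₂)` is the first basis vector. -/
def sliceE (r : Fin 4 → ℂ) : Module.Dual ℂ g := dualPt (r 0) 0 (r 1 / 2) (1 / 2) 1 0 (r 2) (r 3)

theorem ev_monom (x : Module.Dual ℂ g) (n : Fin 4 → ℕ) :
    ev x (monom n) = algebraMap ℂ _ (∏ k, invVal x k ^ n k) := by
  simp only [monom, map_mul, map_pow, ev_a, ev_b, ev_c, ev_d, Fin.prod_univ_four, invVal]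
  rfl

/-- The constants `1 / 2` in the slice are chosen to cancel the factors 4 and 2 in `b` and `d`. -/
theorem invVal_sliceF (r : Fin 4 → ℂ) : invVal (sliceF r) = r := by
  obtain ⟨h0, h1, h2, h3, h4, h5, h6, h7⟩ :=
    dualPt_apply (r 0) 0 (1 / 2) (r 1 / 2) (r 2) (r 3) 1 0
  simp only [invVal, sliceF, h0, h1, h2, h3, h4, h5, h6, h7]
  ext k
  fin_cases k <;> simp
  ring

theorem invVal_sliceE (r : Fin 4 → ℂ) : invVal (sliceE r) = r := by
  obtain ⟨h0, h1, h2, h3, h4, h5, h6, h7⟩ :=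
    dualPt_apply (r 0) 0 (r 1 / 2) (1 / 2) 1 0 (r 2) (r 3)
  simp only [invVal, sliceE, h0, h1, h2, h3, h4, h5, h6, h7]
  ext k
  fin_cases k <;> simp
  ring

/-- A quantity that does not vanish at a point iff the point can be moved to the slice
`sliceF` by a block diagonal matrix without zero entries in its first block. -/
def moveDenom (x : Module.Dual ℂ g) : ℂ :=
  x F₁ * x F₂ * (x H * x F₁ + 2 * x F * x F₂) * (2 * x E * x F₁ - x H * x F₂) *
    (x F₁ * (2 * x E * x F₁ - x H * x F₂) - x F₂ * (x H * x F₁ + 2 * x F * x F₂))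

/-- Let `w = (x F₁, x F₂)` and let `M` be the traceless matrix with rows `(x H, 2 x F)` and `(2 x E,
-x H)`. The columns of the 2 × 2 block are `w` and `Mw`, up to scale. In this basis `w` becomes the
first basis vector, and since `M² = b`, `M` becomes antidiagonal, which is the shape of `sliceF`. -/
theorem exists_map_adP_ev_sliceF (x : Module.Dual ℂ g) (hx : moveDenom x ≠ 0) : ∃ k : KC,
    ∀ φ ∈ invariants, ev x φ = ExteriorAlgebra.map (adP k) (ev (sliceF (invVal x)) φ) := by
  simp only [moveDenom, mul_ne_zero_iff] at hx
  obtain ⟨⟨⟨⟨h1, h2⟩, h3⟩, h4⟩, hW⟩ := hx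
  -- With `δ³ = det(w, Mw)`, dividing both columns by `δ` gives determinant `δ`, hence `κ = δ⁻¹`;
  -- this makes the new value on `F₁` exactly 1.
  obtain ⟨δ, hδ⟩ := IsAlgClosed.exists_pow_nat_eq (x F₁ * (2 * x E * x F₁ - x H * x F₂) -
    x F₂ * (x H * x F₁ + 2 * x F * x F₂)) (n := 3) (by norm_num)
  have hδ0 : δ ≠ 0 := by
    rintro rfl
    exact hW (by rw [← hδ]; simp)
  have hdet : x F₁ / δ * ((2 * x E * x F₁ - x H * x F₂) / δ) -
      (x H * x F₁ + 2 * x F * x F₂) / δ * (x F₂ / δ) = δ := by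
    field_simp
    linear_combination -hδ
  have h : (x F₁ / δ * ((2 * x E * x F₁ - x H * x F₂) / δ) -
      (x H * x F₁ + 2 * x F * x F₂) / δ * (x F₂ / δ)) * δ⁻¹ = 1 := by
    rw [hdet, mul_inv_cancel₀ hδ0]
  refine ⟨blockKC _ _ _ _ _ h, fun φ hφ => ?_⟩
  rw [← pull_blockKC_eq_ev hφ h (div_ne_zero h1 hδ0) (div_ne_zero h3 hδ0) (div_ne_zero h2 hδ0)
    (div_ne_zero h4 hδ0) x, pull_apply]
  congr 2
  obtain ⟨c0, c1, c2, c3, c4, c5, c6, c7⟩ := comp_Ad x _ _ _ _ _ h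
  rw [hdet] at c4 c5
  obtain ⟨s0, s1, s2, s3, s4, s5, s6, s7⟩ := dualPt_apply (invVal x 0) 0 (1 / 2) (invVal x 1 / 2)
    (invVal x 2) (invVal x 3) 1 0
  congr 1
  apply dual_ext
  · rw [c0, sliceF, s0]
    rfl
  · rw [c1, sliceF, s1]
    field_simp
    ring
  · rw [c2, sliceF, s2]
    field_simp
    linear_combination -hδ
  · rw [c3, sliceF, s3]
    simp only [invVal, Matrix.cons_val_one, Matrix.cons_val_zero]
    field_simp
    linear_combination -(x H ^ 2 + 4 * x E * x F) * hδ
  · rw [c4, sliceF, s4]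
    simp [invVal]
    field_simp
  · rw [c5, sliceF, s5]
    simp [invVal]
    field_simp
    ring
  · rw [c6, sliceF, s6]
    field_simp
    linear_combination -hδ
  · rw [c7, sliceF, s7]
    field_simp
    ring

/-! ### Coordinates with respect to `T` on the slices. -/

theorem sum_smul_ev_sliceF (r : Fin 4 → ℂ) (y : Fin 16 → ℂ) :
    ∑ t, y t • ev (sliceF r) (tElem t) = ∑ k, (![y 0, y 1, y 6, r 2 * y 2 + r 3 * y 4,
      r 3 * y 2 + r 1 * r 2 * y 4, y 12, y 3 + r 2 * y 7, r 1 * y 5 + r 3 * y 7,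
      y 5 - r 2 * y 15, y 3 - r 3 * y 15, (r 1 * r 2 ^ 2 - r 3 ^ 2) * y 13, y 11, y 8,
      r 3 * y 9 - r 1 * r 2 * y 14, r 3 * y 14 - r 2 * y 9, -2 * y 10] k : ℂ) • extBasis k := by
  obtain ⟨h0, h1, h2, h3, h4, h5, h6, h7⟩ :=
    dualPt_apply (r 0) 0 (1 / 2) (r 1 / 2) (r 2) (r 3) 1 0
  simp only [extBasis_apply]
  simp only [Fin.sum_univ_succ, tElem, extMon, Matrix.cons_val_succ, Matrix.cons_val_zero,
    Fin.reduceSucc, Finset.univ_eq_empty, Finset.sum_empty, map_mul, map_one, map_pow,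
    ev_e, ev_f, ev_gg, ev_h, ev_i, ev_j, sliceF, h0, h1, h2, h3, h4, h5, h6, h7]
  simp [pow_two, add_mul, mul_add, mul_assoc, ε_sq, ε_sq_assoc, ε_swap, ε_swap_assoc]
  module

theorem sum_smul_ev_sliceE (r : Fin 4 → ℂ) (y : Fin 16 → ℂ) :
    ∑ t, y t • ev (sliceE r) (tElem t) = ∑ k, (![y 0, r 2 * y 1 + r 3 * y 6,
      r 3 * y 1 + r 1 * r 2 * y 6, y 2, y 4, (r 1 * r 2 ^ 2 - r 3 ^ 2) * y 12,
      y 3 + r 2 * y 7 - r 3 * y 15, y 5, r 1 * y 5 + r 3 * y 7 - r 1 * r 2 * y 15, y 3, y 13,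
      r 1 * r 2 * y 11 - r 3 * y 8, r 2 * y 8 - r 3 * y 11, -y 14, -y 9, -2 * y 10] k : ℂ) •
        extBasis k := by
  obtain ⟨h0, h1, h2, h3, h4, h5, h6, h7⟩ :=
    dualPt_apply (r 0) 0 (r 1 / 2) (1 / 2) 1 0 (r 2) (r 3)
  simp only [extBasis_apply]
  simp only [Fin.sum_univ_succ, tElem, extMon, Matrix.cons_val_succ, Matrix.cons_val_zero,
    Fin.reduceSucc, Finset.univ_eq_empty, Finset.sum_empty, map_mul, map_one, map_pow,
    ev_e, ev_f, ev_gg, ev_h, ev_i, ev_j, sliceE, h0, h1, h2, h3, h4, h5, h6, h7]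
  simp [pow_two, add_mul, mul_add, mul_assoc, ε_sq, ε_sq_assoc, ε_swap, ε_swap_assoc]
  module

theorem eq_of_sum_smul_extBasis {u : ExteriorAlgebra ℂ p} {y : Fin 16 → ℂ}
    (hu : u = ∑ k, y k • extBasis k) (k : Fin 16) : extBasis.repr u k = y k := by
  rw [hu, extBasis.repr_sum_self]

/-- The linear system splits into small blocks. Those not solved by inspection reduce to 2 × 2
systems or a single equation with determinant `±(r 1 * r 2 ^ 2 - r 3 ^ 2)`. -/
theorem linearIndependent_ev_sliceF (r : Fin 4 → ℂ) (hr : r 1 * r 2 ^ 2 - r 3 ^ 2 ≠ 0) :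
    LinearIndependent ℂ (fun t => ev (sliceF r) (tElem t)) := by
  rw [Fintype.linearIndependent_iff]
  intro y hy
  rw [sum_smul_ev_sliceF] at hy
  have hz := Fintype.linearIndependent_iff.1 extBasis.linearIndependent _ hy
  have z0 : y 0 = 0 := hz 0
  have z1 : y 1 = 0 := hz 1
  have z2 : y 6 = 0 := hz 2
  have z3 : r 2 * y 2 + r 3 * y 4 = 0 := hz 3
  have z4 : r 3 * y 2 + r 1 * r 2 * y 4 = 0 := hz 4
  have z5 : y 12 = 0 := hz 5
  have z6 : y 3 + r 2 * y 7 = 0 := hz 6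
  have z7 : r 1 * y 5 + r 3 * y 7 = 0 := hz 7
  have z8 : y 5 - r 2 * y 15 = 0 := hz 8
  have z9 : y 3 - r 3 * y 15 = 0 := hz 9
  have z10 : (r 1 * r 2 ^ 2 - r 3 ^ 2) * y 13 = 0 := hz 10
  have z11 : y 11 = 0 := hz 11
  have z12 : y 8 = 0 := hz 12
  have z13 : r 3 * y 9 - r 1 * r 2 * y 14 = 0 := hz 13
  have z14 : r 3 * y 14 - r 2 * y 9 = 0 := hz 14
  have z15 : -2 * y 10 = 0 := hz 15
  have y2 : y 2 = 0 := by
    apply mul_left_cancel₀ hr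
    linear_combination r 1 * r 2 * z3 - r 3 * z4
  have y4 : y 4 = 0 := by
    apply mul_left_cancel₀ hr
    linear_combination r 2 * z4 - r 3 * z3
  have y7 : y 7 = 0 := by
    apply mul_left_cancel₀ hr
    linear_combination r 1 * r 2 * (z6 - z9) - r 3 * (z7 - r 1 * z8)
  have y15 : y 15 = 0 := by
    apply mul_left_cancel₀ hr
    linear_combination r 2 * (z7 - r 1 * z8) - r 3 * (z6 - z9)
  have y9 : y 9 = 0 := by
    apply mul_left_cancel₀ hr
    linear_combination -r 3 * z13 - r 1 * r 2 * z14
  have y14 : y 14 = 0 := by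
    apply mul_left_cancel₀ hr
    linear_combination -r 2 * z13 - r 3 * z14
  have y3 : y 3 = 0 := by linear_combination z9 + r 3 * y15
  have y5 : y 5 = 0 := by linear_combination z8 + r 2 * y15
  have y13 : y 13 = 0 := (mul_eq_zero.1 z10).resolve_left hr
  have y10 : y 10 = 0 := (mul_eq_zero.1 z15).resolve_left (by norm_num)
  intro t
  fin_cases t
  exacts [z0, z1, y2, y3, y4, y5, z2, y7, z12, y9, y10, z11, z5, y13, y14, y15]

/-! ### Polynomiality of the coordinates of an invariant. -/

theorem exists_polynomial_repr_ev (x : (Fin 4 → ℂ) → Module.Dual ℂ g)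
    (hx : ∀ X : g, ∃ P : MvPolynomial (Fin 4) ℂ, ∀ r, x r X = MvPolynomial.eval r P)
    (φ : A) (k : Fin 16) : ∃ P : MvPolynomial (Fin 4) ℂ, ∀ r,
      extBasis.repr (ev (x r) φ) k = MvPolynomial.eval r P := by
  induction φ using TensorProduct.induction_on with
  | zero => exact ⟨0, by simp⟩
  | add u v hu hv =>
    obtain ⟨P, hP⟩ := hu
    obtain ⟨Q, hQ⟩ := hv
    exact ⟨P + Q, fun r => by simp [hP, hQ]⟩
  | tmul y m =>
    have hy : ∃ P : MvPolynomial (Fin 4) ℂ, ∀ r,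
        SymmetricAlgebra.lift (x r) y = MvPolynomial.eval r P := by
      induction y using SymmetricAlgebra.induction with
      | algebraMap r => exact ⟨MvPolynomial.C r, by simp⟩
      | ι X => simpa using hx X
      | mul u v hu hv =>
        obtain ⟨P, hP⟩ := hu
        obtain ⟨Q, hQ⟩ := hv
        exact ⟨P * Q, fun r => by simp [hP, hQ]⟩
      | add u v hu hv =>
        obtain ⟨P, hP⟩ := hu
        obtain ⟨Q, hQ⟩ := hv
        exact ⟨P + Q, fun r => by simp [hP, hQ]⟩
    obtain ⟨P, hP⟩ := hy
    refine ⟨P * MvPolynomial.C (extBasis.repr m k), fun r => ?_⟩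
    rw [ev_tmul, map_smul, Finsupp.smul_apply, hP, map_mul, MvPolynomial.eval_C, smul_eq_mul]

theorem exists_polynomial_dualPt (q : Fin 8 → MvPolynomial (Fin 4) ℂ) (X : g) :
    ∃ P : MvPolynomial (Fin 4) ℂ, ∀ r, dualPt (MvPolynomial.eval r (q 0))
      (MvPolynomial.eval r (q 1)) (MvPolynomial.eval r (q 2)) (MvPolynomial.eval r (q 3))
      (MvPolynomial.eval r (q 4)) (MvPolynomial.eval r (q 5)) (MvPolynomial.eval r (q 6))
      (MvPolynomial.eval r (q 7)) X = MvPolynomial.eval r P :=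
  ⟨q 0 * MvPolynomial.C (-3 / 2 * X.1 2 2) + q 1 * MvPolynomial.C ((X.1 0 0 - X.1 1 1) / 2) +
    q 2 * MvPolynomial.C (X.1 0 1) + q 3 * MvPolynomial.C (X.1 1 0) +
    q 4 * MvPolynomial.C (X.1 0 2) + q 5 * MvPolynomial.C (X.1 1 2) +
    q 6 * MvPolynomial.C (X.1 2 0) + q 7 * MvPolynomial.C (X.1 2 1), fun r => by
      simp only [map_add, map_mul, MvPolynomial.eval_C]
      rfl⟩

open MvPolynomial in
theorem exists_polynomial_sliceF (X : g) :
    ∃ P : MvPolynomial (Fin 4) ℂ, ∀ r, sliceF r X = MvPolynomial.eval r P := by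
  obtain ⟨P, hP⟩ := exists_polynomial_dualPt
    ![MvPolynomial.X 0, 0, C (1 / 2), MvPolynomial.X 1 * C (1 / 2), MvPolynomial.X 2,
      MvPolynomial.X 3, 1, 0] X
  refine ⟨P, fun r => ?_⟩
  rw [← hP]
  simp [sliceF, div_eq_mul_inv]

open MvPolynomial in
theorem exists_polynomial_sliceE (X : g) :
    ∃ P : MvPolynomial (Fin 4) ℂ, ∀ r, sliceE r X = MvPolynomial.eval r P := by
  obtain ⟨P, hP⟩ := exists_polynomial_dualPt
    ![MvPolynomial.X 0, 0, MvPolynomial.X 1 * C (1 / 2), C (1 / 2), 1, 0, MvPolynomial.X 2,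
      MvPolynomial.X 3] X
  refine ⟨P, fun r => ?_⟩
  rw [← hP]
  simp [sliceE, div_eq_mul_inv]

/-- The parameters at which the two slices are conjugate. -/
def sliceDenom (r : Fin 4 → ℂ) : ℂ := r 1 * r 2 * r 3 * (r 1 * r 2 ^ 2 - r 3 ^ 2)

theorem sliceDenom_ne_zero_iff (r : Fin 4 → ℂ) : sliceDenom r ≠ 0 ↔
    r 1 ≠ 0 ∧ r 2 ≠ 0 ∧ r 3 ≠ 0 ∧ r 1 * r 2 ^ 2 - r 3 ^ 2 ≠ 0 := by
  simp only [sliceDenom, mul_ne_zero_iff, and_assoc]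

theorem moveDenom_sliceE (r : Fin 4 → ℂ) (hr : sliceDenom r ≠ 0) :
    moveDenom (sliceE r) ≠ 0 := by
  obtain ⟨r1, r2, r3, hq⟩ := (sliceDenom_ne_zero_iff r).1 hr
  obtain ⟨-, h1, h2, h3, -, -, h6, h7⟩ :=
    dualPt_apply (r 0) 0 (r 1 / 2) (1 / 2) 1 0 (r 2) (r 3)
  have : moveDenom (sliceE r) = r 2 * r 3 * r 3 * (r 1 * r 2) * (r 1 * r 2 ^ 2 - r 3 ^ 2) := by
    simp only [moveDenom, sliceE, h1, h2, h3, h6, h7]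
    ring
  rw [this]
  simp [*]

open MvPolynomial in
theorem mvPolynomial_eq_of_generic {P Q : MvPolynomial (Fin 4) ℂ}
    (h : ∀ r, sliceDenom r ≠ 0 → eval r P = eval r Q) : P = Q := by
  let D : MvPolynomial (Fin 4) ℂ := X 1 * X 2 * X 3 * (X 1 * X 2 ^ 2 - X 3 ^ 2)
  have hD (r : Fin 4 → ℂ) : eval r D = sliceDenom r := by simp [D, sliceDenom]
  -- The value of `D` at `(0, 2, 1, 1)` is 2.
  have hD0 : D ≠ 0 := by
    intro h0
    have := hD ![0, 2, 1, 1]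
    rw [h0] at this
    simp [sliceDenom] at this
    norm_num at this
  rw [← sub_eq_zero]
  refine (mul_eq_zero.1 ?_).resolve_left hD0
  apply MvPolynomial.funext
  intro r
  rw [map_mul, hD, map_sub, map_zero]
  by_cases hr : sliceDenom r = 0
  · rw [hr, zero_mul]
  · rw [h r hr, sub_self, mul_zero]

/-- The point `sliceE r` has invariants `r`, so some `k` carries the values at `sliceF r` of `φ` and
of all of `T` simultaneously to those at `sliceE r`. The linear relation is preserved. -/
theorem exists_coordinates {φ : A} (hφ : φ ∈ invariants) (r : Fin 4 → ℂ)
    (hr : sliceDenom r ≠ 0) : ∃ y : Fin 16 → ℂ,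
    ev (sliceF r) φ = ∑ t, y t • ev (sliceF r) (tElem t) ∧
    ev (sliceE r) φ = ∑ t, y t • ev (sliceE r) (tElem t) := by
  have hli := linearIndependent_ev_sliceF r ((sliceDenom_ne_zero_iff r).1 hr).2.2.2
  let B := basisOfLinearIndependentOfCardEqFinrank hli (by simp [finrank_exteriorAlgebra_p])
  have hB (t : Fin 16) : B t = ev (sliceF r) (tElem t) := by simp [B]
  have h1 : ev (sliceF r) φ = ∑ t, B.repr (ev (sliceF r) φ) t • ev (sliceF r) (tElem t) := by
    simp only [← hB]
    exact (B.sum_repr _).symm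
  refine ⟨fun t => B.repr (ev (sliceF r) φ) t, h1, ?_⟩
  obtain ⟨k, hk⟩ := exists_map_adP_ev_sliceF _ (moveDenom_sliceE r hr)
  rw [hk φ hφ, invVal_sliceE]
  conv_lhs => rw [h1]
  rw [map_sum]
  refine Finset.sum_congr rfl fun t _ => ?_
  rw [map_smul, hk _ (tElem_mem t), invVal_sliceE]

open MvPolynomial in
theorem X_two_dvd_of_X_three_mul_eq {P Q : MvPolynomial (Fin 4) ℂ} (h : X 3 * P = X 2 * Q) :
    X 2 ∣ P := by
  refine (MvPolynomial.X_prime.dvd_or_dvd (Dvd.intro _ h.symm)).resolve_left ?_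
  rw [MvPolynomial.X_dvd_X]
  decide

open MvPolynomial in
-- Each slice isolates seven coordinates, so these are polynomial. The other two, `y 7` and `y 15`,
-- appear with factors `r 2` and `r 3` in separate equations. Both `r 2 * y` and `r 3 * y` are then
-- polynomial, and `X 2` must divide the former.
theorem exists_polynomial_coordinates {φ : A} (hφ : φ ∈ invariants) :
    ∃ P : Fin 16 → MvPolynomial (Fin 4) ℂ, ∀ r, sliceDenom r ≠ 0 →
      ev (sliceF r) φ = ∑ t, eval r (P t) • ev (sliceF r) (tElem t) := by
  choose QF hQF using exists_polynomial_repr_ev sliceF exists_polynomial_sliceF φ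
  choose QE hQE using exists_polynomial_repr_ev sliceE exists_polynomial_sliceE φ
  have key (r : Fin 4 → ℂ) (hr : sliceDenom r ≠ 0) : ∃ y : Fin 16 → ℂ,
      ev (sliceF r) φ = ∑ t, y t • ev (sliceF r) (tElem t) ∧
      (y 0 = eval r (QF 0) ∧ y 1 = eval r (QF 1) ∧ y 6 = eval r (QF 2) ∧ y 12 = eval r (QF 5) ∧
        y 11 = eval r (QF 11) ∧ y 8 = eval r (QF 12) ∧ -2 * y 10 = eval r (QF 15)) ∧
      (y 2 = eval r (QE 3) ∧ y 4 = eval r (QE 4) ∧ y 5 = eval r (QE 7) ∧ y 3 = eval r (QE 9) ∧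
        y 13 = eval r (QE 10) ∧ -y 14 = eval r (QE 13) ∧ -y 9 = eval r (QE 14)) ∧
      (y 3 + r 2 * y 7 = eval r (QF 6) ∧ r 1 * y 5 + r 3 * y 7 = eval r (QF 7)) ∧
      y 5 - r 2 * y 15 = eval r (QF 8) ∧ y 3 - r 3 * y 15 = eval r (QF 9) := by
    obtain ⟨y, hF, hE⟩ := exists_coordinates hφ r hr
    refine ⟨y, hF, ?_⟩
    rw [sum_smul_ev_sliceF] at hF
    rw [sum_smul_ev_sliceE] at hE
    have zF (k : Fin 16) := (eq_of_sum_smul_extBasis hF k).symm.trans (hQF k r)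
    have zE (k : Fin 16) := (eq_of_sum_smul_extBasis hE k).symm.trans (hQE k r)
    exact ⟨⟨zF 0, zF 1, zF 2, zF 5, zF 11, zF 12, zF 15⟩,
      ⟨zE 3, zE 4, zE 7, zE 9, zE 10, zE 13, zE 14⟩, ⟨zF 6, zF 7⟩, zF 8, zF 9⟩
  obtain ⟨R₇, hR₇⟩ : X 2 ∣ QF 6 - QE 9 := by
    apply X_two_dvd_of_X_three_mul_eq (Q := QF 7 - X 1 * QE 7)
    apply mvPolynomial_eq_of_generic
    intro r hr
    obtain ⟨y, -, -, ⟨-, -, h5, h3, -⟩, ⟨h6, h7⟩, -⟩ := key r hr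
    simp only [map_mul, map_sub, eval_X, ← h5, ← h3, ← h6, ← h7]
    ring
  obtain ⟨R₁₅, hR₁₅⟩ : X 2 ∣ QE 7 - QF 8 := by
    apply X_two_dvd_of_X_three_mul_eq (Q := QE 9 - QF 9)
    apply mvPolynomial_eq_of_generic
    intro r hr
    obtain ⟨y, -, -, ⟨-, -, h5, h3, -⟩, -, h8, h9⟩ := key r hr
    simp only [map_mul, map_sub, eval_X, ← h5, ← h3, ← h8, ← h9]
    ring
  refine ⟨![QF 0, QF 1, QE 3, QE 9, QE 4, QE 7, QF 2, R₇, QF 12, -QE 14, C (-1 / 2) * QF 15,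
    QF 11, QF 5, QE 10, -QE 13, R₁₅], fun r hr => ?_⟩
  obtain ⟨y, hy, ⟨h0, h1, h6, h12, h11, h8, h10⟩, ⟨h2, h4, h5, h3, h13, h14, h9⟩, ⟨g6, g7⟩,
    g8, g9⟩ := key r hr
  have hr2 := ((sliceDenom_ne_zero_iff r).1 hr).2.1
  have h7 : y 7 = eval r R₇ := by
    apply mul_left_cancel₀ hr2
    have := congrArg (eval r) hR₇
    rw [map_sub, map_mul, eval_X] at this
    linear_combination this + g6 - h3
  have h15 : y 15 = eval r R₁₅ := by
    apply mul_left_cancel₀ hr2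
    have := congrArg (eval r) hR₁₅
    rw [map_sub, map_mul, eval_X] at this
    linear_combination this - g8 + h5
  rw [hy]
  refine Finset.sum_congr rfl fun t _ => ?_
  congr 1
  fin_cases t
  exacts [h0, h1, h2, h3, h4, h5, h6, h7, h8, by simp [← h9], by simp [← h10]; ring, h11, h12, h13,
    by simp [← h14], h15]

/-! ### From the slice back to the algebra of invariants. -/

/-- The element of `S(𝔤)` whose nonvanishing at a point makes both slices reachable. -/
def genericPoly : SymmetricAlgebra ℂ g :=
  let y := SymmetricAlgebra.ι ℂ g
  let B := y H ^ 2 + 4 * y E * y F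
  let C := y E₁ * y F₁ + y E₂ * y F₂
  let D := 2 * y E * y E₂ * y F₁ + y H * y E₁ * y F₁ - y H * y E₂ * y F₂ + 2 * y F * y E₁ * y F₂
  (y F₁ * y F₂ * (y H * y F₁ + 2 * y F * y F₂) * (2 * y E * y F₁ - y H * y F₂) *
    (y F₁ * (2 * y E * y F₁ - y H * y F₂) - y F₂ * (y H * y F₁ + 2 * y F * y F₂))) *
    (B * C * D * (B * C ^ 2 - D ^ 2))

theorem lift_genericPoly (x : Module.Dual ℂ g) : SymmetricAlgebra.lift x genericPoly =
    moveDenom x * sliceDenom (invVal x) := by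
  have h2 : SymmetricAlgebra.lift x (2 : SymmetricAlgebra ℂ g) = 2 := map_ofNat _ 2
  have h4 : SymmetricAlgebra.lift x (4 : SymmetricAlgebra ℂ g) = 4 := map_ofNat _ 4
  simp only [genericPoly, map_mul, map_add, map_sub, map_pow, SymmetricAlgebra.lift_ι_apply,
    h2, h4]
  rfl

theorem genericPoly_ne_zero : genericPoly ≠ 0 := by
  intro h
  have hs : sliceDenom ![0, 2, 1, 1] ≠ 0 := by
    simp [sliceDenom]
    norm_num
  have := lift_genericPoly (sliceE ![0, 2, 1, 1])
  rw [h, map_zero, invVal_sliceE] at this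
  exact mul_ne_zero (moveDenom_sliceE _ hs) hs this.symm

/-- Off the zero set of `genericPoly`, each point is conjugate to a generic point of `sliceF`, and
equivariance carries the equality there. -/
theorem eq_of_ev_sliceF_eq {φ ψ : A} (hφ : φ ∈ invariants) (hψ : ψ ∈ invariants)
    (h : ∀ r, sliceDenom r ≠ 0 → ev (sliceF r) φ = ev (sliceF r) ψ) : φ = ψ := by
  rw [← sub_eq_zero]
  refine eq_zero_of_ev_eq_zero _ genericPoly genericPoly_ne_zero fun x hx => ?_
  rw [lift_genericPoly, mul_ne_zero_iff] at hx
  obtain ⟨k, hk⟩ := exists_map_adP_ev_sliceF x hx.1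
  rw [hk _ (sub_mem hφ hψ), map_sub, h _ hx.2, sub_self, map_zero]

theorem ev_sliceF_monom_mul (r : Fin 4 → ℂ) (n : Fin 4 → ℕ) (t : Fin 16) :
    ev (sliceF r) (monom n * tElem t) = (∏ k, r k ^ n k) • ev (sliceF r) (tElem t) := by
  rw [map_mul, ev_monom, invVal_sliceF, ← Algebra.smul_def]

theorem linearIndependent_monom_mul_tElem :
    LinearIndependent ℂ (fun q : (Fin 4 → ℕ) × Fin 16 => monom q.1 * tElem q.2) := by
  classical
  rw [linearIndependent_iff']
  intro s y hy q hq
  -- On the slice `monom n` is an honest monomial in `r`, so the relation becomes one among the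
  -- values of `T` with polynomial coefficients `P t`.
  let P (t : Fin 16) : MvPolynomial (Fin 4) ℂ := ∑ q ∈ s,
    if q.2 = t then MvPolynomial.monomial (Finsupp.equivFunOnFinite.symm q.1) (y q) else 0
  have hP (r : Fin 4 → ℂ) (t : Fin 16) : MvPolynomial.eval r (P t) =
      ∑ q ∈ s, if q.2 = t then y q * ∏ k, r k ^ q.1 k else 0 := by
    simp only [P, map_sum]
    refine Finset.sum_congr rfl fun q _ => ?_
    split_ifs
    · rw [MvPolynomial.eval_monomial, Finsupp.prod_fintype _ _ (fun _ => pow_zero _)]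
      rfl
    · exact map_zero _
  have hP0 (t : Fin 16) : P t = 0 := by
    apply mvPolynomial_eq_of_generic
    intro r hr
    rw [map_zero]
    have hsum : ∑ t, MvPolynomial.eval r (P t) • ev (sliceF r) (tElem t) = 0 := by
      have h1 := congrArg (ev (sliceF r)) hy
      rw [map_zero, map_sum] at h1
      rw [← h1]
      simp only [hP, Finset.sum_smul]
      rw [Finset.sum_comm]
      refine Finset.sum_congr rfl fun q _ => ?_
      rw [map_smul, ev_sliceF_monom_mul, smul_smul]
      simp only [ite_smul, zero_smul, Finset.sum_ite_eq, Finset.mem_univ, if_true]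
    exact Fintype.linearIndependent_iff.1
      (linearIndependent_ev_sliceF r ((sliceDenom_ne_zero_iff r).1 hr).2.2.2) _ hsum t
  have hc := congrArg (MvPolynomial.coeff (Finsupp.equivFunOnFinite.symm q.1)) (hP0 q.2)
  simp only [P, MvPolynomial.coeff_sum, MvPolynomial.coeff_zero] at hc
  rw [Finset.sum_eq_single_of_mem q hq] at hc
  · simpa using hc
  · intro q' _ hne
    split_ifs with h2
    · rw [MvPolynomial.coeff_monomial, if_neg]
      intro h1
      exact hne (Prod.ext (Finsupp.equivFunOnFinite.symm.injective h1) h2)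
    · exact MvPolynomial.coeff_zero _

theorem ST_eq_range :
    ST = Set.range (fun q : (Fin 4 → ℕ) × Fin 16 => monom q.1 * tElem q.2) := by
  ext x
  rw [ST, T_eq_range, S]
  constructor
  · rintro ⟨_, ⟨n, rfl⟩, _, ⟨t, rfl⟩, rfl⟩
    exact ⟨(n, t), rfl⟩
  · rintro ⟨⟨n, t⟩, rfl⟩
    exact ⟨_, ⟨n, rfl⟩, _, ⟨t, rfl⟩, rfl⟩

theorem span_ST : Submodule.span ℂ ST = Subalgebra.toSubmodule invariants := by
  apply le_antisymm
  · rw [Submodule.span_le, ST_eq_range]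
    rintro _ ⟨⟨n, t⟩, rfl⟩
    exact (mul_mem (monom_mem n) (tElem_mem t) : _ ∈ invariants)
  · intro φ hφ
    rw [Subalgebra.mem_toSubmodule] at hφ
    obtain ⟨P, hP⟩ := exists_polynomial_coordinates hφ
    have hmem (t : Fin 16) (n : Fin 4 →₀ ℕ) : monom n * tElem t ∈ invariants :=
      mul_mem (monom_mem n) (tElem_mem t)
    -- The right side is obtained by substituting `a, b, c, d` for the variables of the coordinate
    -- polynomials; it agrees with `φ` on the generic part of `sliceF`.
    have h : φ = ∑ t, ∑ n ∈ (P t).support, (P t).coeff n • (monom n * tElem t) := by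
      refine eq_of_ev_sliceF_eq hφ (sum_mem fun t _ => sum_mem fun n _ =>
        Subalgebra.smul_mem _ (hmem t n) _) fun r hr => ?_
      rw [hP r hr, map_sum]
      refine Finset.sum_congr rfl fun t _ => ?_
      rw [map_sum, MvPolynomial.eval_eq', Finset.sum_smul]
      refine Finset.sum_congr rfl fun n _ => ?_
      rw [map_smul, ev_sliceF_monom_mul, smul_smul]
    rw [h]
    refine sum_mem fun t _ => sum_mem fun n _ => Submodule.smul_mem _ _
      (Submodule.subset_span ?_)
    rw [ST_eq_range]
    exact ⟨(n, t), rfl⟩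

end SU21

end

theorem mainTheorem3 :
    SU21.S ⊆ (SU21.invariants : Set SU21.A) ∧
    SU21.T ⊆ (SU21.invariants : Set SU21.A) ∧
    LinearIndependent ℂ (fun q : (Fin 4 → ℕ) × Fin 16 => SU21.monom q.1 * SU21.tElem q.2) ∧
    LinearIndepOn ℂ id SU21.ST ∧
    Submodule.span ℂ SU21.ST = Subalgebra.toSubmodule SU21.invariants := by
  refine ⟨?_, ?_, SU21.linearIndependent_monom_mul_tElem, ?_, SU21.span_ST⟩
  · rintro _ ⟨n, rfl⟩
    exact SU21.monom_mem n
  · rw [SU21.T_eq_range]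
    rintro _ ⟨t, rfl⟩
    exact SU21.tElem_mem t
  · rw [SU21.ST_eq_range]
    exact SU21.linearIndependent_monom_mul_tElem.linearIndepOn_id
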